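/- **Setting.** Let $X\subset\mathbb R^d$, $Y\subset\mathbb R^{d'}$ be compact convex sets with $\|x\|^2\le D_X$ on $X$ and $\|y\|^2\le D_Y$ on $Y$, let $\mathbb P$ be a probability measure on a sample space $\mathcal Z$, and let $f(x,y;z)$ be, for every $z\in\mathcal Z$, differentiable at the points of $X\times Y$ with a gradient that is $\beta$-Lipschitz on $X\times Y$ ("$\beta$-smooth"), $\mu_x$-strongly convex in $x\in X$ for every $y\in Y$ and $\mu_y$-strongly concave in $y\in Y$ for every $x\in X$ ($\beta,\mu_x,\mu_y,D_X,D_Y>0$). Put $F(x,y)=\mathbb E_{z\sim\mathbb P}f(x,y;z)$ and $\Phi(x)=\max_{y\in Y}F(x,y)$, and let $(x^*,y^*)\in X\times Y$ solve $\min_{x\in X}\max_{y\in Y}F(x,y)$; let $R_1$ be such that $\|x-x^*\|\le R_1$ for all $x\in X$. Assume the Bernstein condition at $(x^*,y^*)$: for some $B_{x^*},B_{y^*}>0$ and all integers $k\ge2$, $$\mathbb E\|\nabla_xf(x^*,y^*;z)\|^k\le\tfrac{k!}{2}\,\mathbb E\|\nabla_xf(x^*,y^*;z)\|^2\,B_{x^*}^{k-2},\qquad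 \mathbb E\|\nabla_yf(x^*,y^*;z)\|^k\le\tfrac{k!}{2}\,\mathbb E\|\nabla_yf(x^*,y^*;z)\|^2\,B_{y^*}^{k-2}$$ (all these moments being finite). For an i.i.d. sample $S=(z_1,\dots,z_n)$ from $\mathbb P$, $n\ge1$, let $F_S(x,y)=\frac1n\sum_if(x,y;z_i)$ and let gradient descent ascent (GDA) be $(x_1,y_1)=(0,0)$, $x_{t+1}=x_t-\eta_x\nabla_xF_S(x_t,y_t)$, $y_{t+1}=y_t+\eta_y\nabla_yF_S(x_t,y_t)$ with $\eta_x=\frac1{16(\beta/\mu_y+1)^2\beta}$, $\eta_y=\frac1\beta$, and $\bar x_T=\frac1T\sum_{t=1}^Tx_t$. "With probability at least $1-\delta$, $\Phi(\bar x_T)-\Phi(x^*)\le\varepsilon$" means: there is an event of probability at least $1-\delta$ such that the inequality holds for every sample in it for which the iterates $(x_t,y_t)$, $1\le t\le T$, lie in $X\times Y$ (the domain of the problem). **Theorem.** There is an absolute constant $c>0$ such that the following holds for all $a,b>0$, all $\delta\in(0,1)$, and all $n\ge1$ with $$n\ \ge\ \frac{c\,\beta^2(\mu_y+\beta)^4\Big(d+\log\frac{16\log_2(\sqrt2R_1n+1)}{\delta}\Big)}{\mu_y^4\mu_x^2}.$$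 1. There is $C_1$ depending only on $\beta,\mu_x,\mu_y,B_{x^*},B_{y^*},D_X,D_Y,a,b$ such that, if $an\le T\le bn$, then with probability at least $1-\delta$ $$\Phi(\bar x_T)-\Phi(x^*)\le C_1\Big(\frac{\mathbb E\|\nabla_xf(x^*,y^*;z)\|^2\log\frac8\delta}{n}+\frac{\mathbb E\|\nabla_yf(x^*,y^*;z)\|^2\log\frac8\delta}{n}+\frac{\log^2\frac8\delta}{n^2}\Big).$$ 2. Let $an^2\le T\le bn^2$, and let $f(\cdot,\cdot;z)$ be non-negative and $\beta$-smooth on all of $\mathbb R^d\times\mathbb R^{d'}$ for every $z$. Then with probability at least $1-\delta$ $$\Phi(\bar x_T)-\Phi(x^*)\le C_1\Big(\frac{\Phi(x^*)\log\frac8\delta}{n}+\frac{\log^2\frac8\delta}{n^2}\Big),$$ with $C_1$ depending only on the same parameters. If moreover $\Phi(x^*)\le K/n$, where $K>0$, then with probability at least $1-\delta$ $$\Phi(\bar x_T)-\Phi(x^*)\le C_2\,\frac{\log^2\frac8\delta}{n^2},$$ where $C_2$ depends only on the same parameters and on $K$. 3. If $f$ is only assumed to be non-negative on $X\times Y\times\mathcal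 Z$, then both bounds of part 2 hold with constants $C_1,C_2$ that may depend on the whole problem $(X,Y,\mathcal Z,\mathbb P,f,x^*,y^*,R_1)$ as well, but not on $n,T,\delta$. -/

import Mathlib

open MeasureTheory

universe u

noncomputable section

namespace Minimax

/-- `ℝ^d` with the Euclidean norm. -/
abbrev Vec (d : ℕ) : Type := EuclideanSpace ℝ (Fin d)

/-- A differentiable function `g` is `μ`-strongly convex on the set `s`. -/
def IsStronglyConvexOn {d : ℕ} (μ : ℝ) (s : Set (Vec d)) (g : Vec d → ℝ) : Prop :=
  (∀ w ∈ s, DifferentiableAt ℝ g w) ∧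
    ∀ w₁ ∈ s, ∀ w₂ ∈ s,
      inner ℝ (gradient g w₂) (w₁ - w₂) + μ / 2 * ‖w₁ - w₂‖ ^ 2 ≤ g w₁ - g w₂

/-- `g` is `μ`-strongly concave on `s` if `-g` is `μ`-strongly convex on `s`. -/
def IsStronglyConcaveOn {d : ℕ} (μ : ℝ) (s : Set (Vec d)) (g : Vec d → ℝ) : Prop :=
  IsStronglyConvexOn μ s (fun w => -g w)

section Gradients

variable {d d' : ℕ} {Z : Type*}

/-- The partial gradient `∇_x f(x, y; z)`. -/
def gradX (f : Vec d → Vec d' → Z → ℝ) (x : Vec d) (y : Vec d') (z : Z) : Vec d :=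
  gradient (fun x' => f x' y z) x

/-- The partial gradient `∇_y f(x, y; z)`. -/
def gradY (f : Vec d → Vec d' → Z → ℝ) (x : Vec d) (y : Vec d') (z : Z) : Vec d' :=
  gradient (fun y' => f x y' z) y

/-- `f` is `β`-smooth in `(x, y) ∈ X × Y`, uniformly in `z`: it is jointly differentiable at the
points of `X × Y`, and its gradient is `β`-Lipschitz (hence continuous) on `X × Y`. -/
def IsSmoothOn (β : ℝ) (X : Set (Vec d)) (Y : Set (Vec d')) (f : Vec d → Vec d' → Z → ℝ) :
    Prop :=
  (∀ x ∈ X, ∀ y ∈ Y, ∀ z : Z,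
      DifferentiableAt ℝ (fun p : Vec d × Vec d' => f p.1 p.2 z) (x, y)) ∧
    ∀ x₁ ∈ X, ∀ x₂ ∈ X, ∀ y₁ ∈ Y, ∀ y₂ ∈ Y, ∀ z : Z,
      √(‖gradX f x₁ y₁ z - gradX f x₂ y₂ z‖ ^ 2 + ‖gradY f x₁ y₁ z - gradY f x₂ y₂ z‖ ^ 2) ≤
        β * √(‖x₁ - x₂‖ ^ 2 + ‖y₁ - y₂‖ ^ 2)

end Gradients

/-- Strongly-convex-strongly-concave problem on compact convex sets. -/
structure IsSCSC {d d' : ℕ} {Z : Type*} (β μx μy DX DY : ℝ) (X : Set (Vec d)) (Y : Set (Vec d'))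
    (f : Vec d → Vec d' → Z → ℝ) : Prop where
  convex_X : Convex ℝ X
  convex_Y : Convex ℝ Y
  compact_X : IsCompact X
  compact_Y : IsCompact Y
  bound_X : ∀ x ∈ X, ‖x‖ ^ 2 ≤ DX
  bound_Y : ∀ y ∈ Y, ‖y‖ ^ 2 ≤ DY
  smooth : IsSmoothOn β X Y f
  convex_x : ∀ y ∈ Y, ∀ z : Z, IsStronglyConvexOn μx X (fun x => f x y z)
  concave_y : ∀ x ∈ X, ∀ z : Z, IsStronglyConcaveOn μy Y (fun y => f x y z)

section Risks

variable {d d' : ℕ} {Z : Type*}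

/-- The empirical risk `F_S(x, y)` of a sample `S` of size `n`. -/
def empRisk (f : Vec d → Vec d' → Z → ℝ) {n : ℕ} (S : Fin n → Z) (x : Vec d) (y : Vec d') : ℝ :=
  (1 / (n : ℝ)) * ∑ i, f x y (S i)

variable [MeasurableSpace Z]

/-- The population risk `F(x, y)`. -/
def popRisk (P : Measure Z) (f : Vec d → Vec d' → Z → ℝ) (x : Vec d) (y : Vec d') : ℝ :=
  ∫ z, f x y z ∂P

/-- The primal population function `Φ(x) = max_{y ∈ Y} F(x, y)`. -/
def primal (P : Measure Z) (Y : Set (Vec d')) (f : Vec d → Vec d' → Z → ℝ) (x : Vec d) : ℝ :=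
  sSup (popRisk P f x '' Y)

/-- `(xs, ys)` solves `min_{x ∈ X} max_{y ∈ Y} F(x, y)`. -/
structure IsMinimaxSolution (P : Measure Z) (X : Set (Vec d)) (Y : Set (Vec d'))
    (f : Vec d → Vec d' → Z → ℝ) (xs : Vec d) (ys : Vec d') : Prop where
  mem_X : xs ∈ X
  mem_Y : ys ∈ Y
  isMin : IsMinOn (primal P Y f) X xs
  isMax : IsMaxOn (popRisk P f xs) Y ys

/-- The Bernstein condition with constant `B` for the random vector `g`; all the moments that
it mentions are required to be finite. -/
def BernsteinCondition (P : Measure Z) (g : Z → Vec d) (B : ℝ) : Prop :=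
  AEStronglyMeasurable g P ∧
    ∀ k : ℕ, 2 ≤ k →
      Integrable (fun z => ‖g z‖ ^ k) P ∧
        ∫ z, ‖g z‖ ^ k ∂P ≤ (k.factorial : ℝ) / 2 * (∫ z, ‖g z‖ ^ 2 ∂P) * B ^ (k - 2)

end Risks

/-- The strongly-convex-strongly-concave setting with a solution `(xs, ys)` of the population
problem at which the Bernstein condition holds, and with `X` inside the ball of radius `R₁`
around `xs`. -/
structure Setting {d d' : ℕ} {Z : Type*} [MeasurableSpace Z] (β μx μy Bx By DX DY R₁ : ℝ)
    (P : Measure Z) (X : Set (Vec d)) (Y : Set (Vec d')) (f : Vec d → Vec d' → Z → ℝ)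
    (xs : Vec d) (ys : Vec d') : Prop where
  scsc : IsSCSC β μx μy DX DY X Y f
  integrable : ∀ x ∈ X, ∀ y ∈ Y, Integrable (f x y) P
  solution : IsMinimaxSolution P X Y f xs ys
  radius : X ⊆ Metric.closedBall xs R₁
  bernstein_x : BernsteinCondition P (gradX f xs ys) Bx
  bernstein_y : BernsteinCondition P (gradY f xs ys) By

section Algorithm

variable {d d' : ℕ}

/-- Two-timescale gradient descent ascent for `G`, started at the origin. The value at `t`
is the pair `(x_{t+1}, y_{t+1})`. -/
def gda (ηx ηy : ℝ) (G : Vec d → Vec d' → ℝ) : ℕ → Vec d × Vec d'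
  | 0 => (0, 0)
  | t + 1 =>
    let w := gda ηx ηy G t
    (w.1 - ηx • gradient (fun x => G x w.2) w.1, w.2 + ηy • gradient (fun y => G w.1 y) w.2)

variable {Z : Type*}

/-- Gradient descent ascent on the empirical risk of `S` with the step sizes
`η_x = 1 / (16 (β/μ_y + 1)² β)` and `η_y = 1/β`. -/
def gdaIter (β μy : ℝ) (f : Vec d → Vec d' → Z → ℝ) {n : ℕ} (S : Fin n → Z) :
    ℕ → Vec d × Vec d' :=
  gda (1 / (16 * (β / μy + 1) ^ 2 * β)) (1 / β) (empRisk f S)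

/-- The average `(x_1 + ⋯ + x_T) / T` of the first `T` iterates. -/
def gdaAvg (β μy : ℝ) (f : Vec d → Vec d' → Z → ℝ) {n : ℕ} (S : Fin n → Z) (T : ℕ) : Vec d :=
  (1 / (T : ℝ)) • ∑ t ∈ Finset.range T, (gdaIter β μy f S t).1

/-- The iterates `(x_t, y_t)`, `1 ≤ t ≤ T`, lie in the domain `X × Y` of the problem. -/
def StaysInDomain (β μy : ℝ) (X : Set (Vec d)) (Y : Set (Vec d')) (f : Vec d → Vec d' → Z → ℝ)
    {n : ℕ} (S : Fin n → Z) (T : ℕ) : Prop :=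
  ∀ t < T, (gdaIter β μy f S t).1 ∈ X ∧ (gdaIter β μy f S t).2 ∈ Y

/-- With probability at least `1 - δ` over an i.i.d. sample `S` of size `n`, the excess primal
risk of the averaged iterate is at most `ε`, provided that the iterates that are averaged lie in
`X × Y`, where `f` satisfies the assumptions of the problem. -/
def ExcessRiskBound [MeasurableSpace Z] (β μy : ℝ) (P : Measure Z) [IsProbabilityMeasure P]
    (X : Set (Vec d)) (Y : Set (Vec d')) (f : Vec d → Vec d' → Z → ℝ) (xs : Vec d)
    (n T : ℕ) (δ ε : ℝ) : Prop :=
  ∃ A : Set (Fin n → Z), MeasurableSet A ∧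
    ENNReal.ofReal (1 - δ) ≤ Measure.pi (fun _ : Fin n => P) A ∧
    ∀ S ∈ A, StaysInDomain β μy X Y f S T →
      primal P Y f (gdaAvg β μy f S T) - primal P Y f xs ≤ ε

end Algorithm

/-- The sample size requirement, with the constant `c`. -/
def LargeSample (c β μx μy R₁ : ℝ) (d n : ℕ) (δ : ℝ) : Prop :=
  c * β ^ 2 * (μy + β) ^ 4 *
      ((d : ℝ) + Real.log (16 * Real.logb 2 (√2 * R₁ * n + 1) / δ)) / (μy ^ 4 * μx ^ 2) ≤ n

end Minimax

end

/-! Everything reduces to the deviation `e` of the empirical gradients from their means at the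
single point `(xs, ys)`, so no uniform convergence over `X × Y` is needed.

Optimization: for a smooth strongly-convex-strongly-concave function, the primal gap plus a multiple
of the squared distance from `y_t` to the best response to `x_t` is a Lyapunov function of gradient
descent ascent and decays geometrically (`lyapunov_step_le`, `lyapunov_le`). Its square roots are
therefore summable. They dominate the gradients of the empirical risk along the iterates, so the sum
of these gradient norms is bounded independently of `T` (`residual_le`).

Comparison: strong monotonicity of the empirical gradient field, together with the first-order
optimality of `(xs, ys)` for the population, bounds the distance of an iterate to `(xs, ys)` by the
gradients there plus `e`. Averaging puts the averaged iterate within `O(e + 1/T)` of `xs`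
(`norm_average_sub_le`). The mean gradient `G` at `(xs, ys)` need not vanish, since `xs` may lie on
the boundary of `X`. But unprojected iterates that stay in the domain have small empirical
gradients, and this forces `‖G‖ = O(e + 1/T)` (`norm_gradient_le`). As the primal function satisfies
`Φ(x) - Φ(xs) ≤ ⟨G, x - xs⟩ + L ‖x - xs‖²`, the excess risk is `O((e + 1/T)²)`.

Statistics: a dimension-free Bernstein inequality bounds `e²` by a multiple of `V u + u²` with `u =
log(8/δ)/n` and `V` the second moment of the gradients, which gives part 1. For part 2 a
non-negative function smooth on the whole space is self-bounding, so `V ≤ 4βΦ(xs)`.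

For part 3 the ratio `V / Φ(xs)` goes into the constant when `Φ(xs) > 0`. When `Φ(xs) = 0`, the set
`Y` is a single point. If `G ≠ 0`, the bound on `‖G‖` keeps `u` away from zero, so `u = O(u²)`. If
`G = 0`, almost every gradient in `x` is orthogonal to `X - xs`, so the relevant deviation is zero.
-/

noncomputable section

namespace Minimax

/-! ### Exponential moments of sums of independent vectors in a Hilbert space. -/

section Bernstein

/-- The series of `cosh √s` in powers of `s` has non-negative coefficients, so it is convex in `s ≥
0`. -/
theorem cosh_le_of_sq_eq {θ p q r : ℝ} (h0 : 0 ≤ θ) (h1 : θ ≤ 1)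
    (h : r ^ 2 = θ * p ^ 2 + (1 - θ) * q ^ 2) :
    Real.cosh r ≤ θ * Real.cosh p + (1 - θ) * Real.cosh q := by
  refine hasSum_le (fun k => ?_) (Real.hasSum_cosh r)
    (((Real.hasSum_cosh p).mul_left θ).add ((Real.hasSum_cosh q).mul_left (1 - θ)))
  have hk := (convexOn_pow k).2 (sq_nonneg p) (sq_nonneg q) h0 (sub_nonneg.2 h1) (by ring)
  simp only [smul_eq_mul] at hk
  rw [← h] at hk
  rw [pow_mul, pow_mul, pow_mul, ← mul_div_assoc, ← mul_div_assoc, ← add_div]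
  gcongr

variable {E : Type*} [NormedAddCommGroup E] [InnerProductSpace ℝ E]

/-- If `c` is the cosine of the angle between `v` and `h`, then `‖v + h‖²` is the average of `(‖v‖ +
‖h‖)²` and `(‖v‖ - ‖h‖)²` with weights `(1 ± c)/2`, and convexity of `cosh √s` applies. The term
linear in `h` is separated out so that it integrates to zero for a centered `h`. -/
theorem cosh_norm_add_le (v h : E) :
    Real.cosh ‖v + h‖ ≤ Real.cosh ‖v‖ + Real.sinh ‖v‖ / ‖v‖ * inner ℝ v h +
      Real.cosh ‖v‖ * (Real.exp ‖h‖ - 1 - ‖h‖) := by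
  obtain ⟨c, hc, hvh⟩ : ∃ c : ℝ, |c| ≤ 1 ∧ inner ℝ v h = ‖v‖ * ‖h‖ * c := by
    refine ⟨inner ℝ v h / (‖v‖ * ‖h‖), abs_real_inner_div_norm_mul_norm_le_one v h, ?_⟩
    by_cases h0 : ‖v‖ * ‖h‖ = 0
    · have := abs_real_inner_le_norm v h
      rw [h0] at this ⊢
      simpa using this
    · exact (mul_div_cancel₀ _ h0).symm
  obtain ⟨hc1, hc2⟩ := abs_le.1 hc
  have key := cosh_le_of_sq_eq (θ := (1 + c) / 2) (p := ‖v‖ + ‖h‖) (q := ‖v‖ - ‖h‖)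
    (r := ‖v + h‖) (by linarith) (by linarith) (by
      rw [norm_add_sq_real, hvh]; ring)
  rw [Real.cosh_add, Real.cosh_sub] at key
  have hlin : Real.sinh ‖v‖ / ‖v‖ * inner ℝ v h = Real.sinh ‖v‖ * ‖h‖ * c := by
    rw [hvh]
    by_cases h0 : ‖v‖ = 0
    · simp [h0]
    · field_simp
  rw [hlin, ← Real.cosh_add_sinh ‖h‖]
  have hs : ‖h‖ ≤ Real.sinh ‖h‖ := Real.self_le_sinh_iff.2 (norm_nonneg _)
  have hv : c * Real.sinh ‖v‖ ≤ Real.cosh ‖v‖ := by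
    have h1 : 0 ≤ Real.sinh ‖v‖ := Real.sinh_nonneg_iff.2 (norm_nonneg _)
    nlinarith [Real.sinh_lt_cosh ‖v‖]
  nlinarith [mul_le_mul_of_nonneg_right hv (sub_nonneg.2 hs)]

variable [CompleteSpace E]
  {Z : Type*} [MeasurableSpace Z] {P : Measure Z} [IsProbabilityMeasure P]

theorem lintegral_cosh_norm_add_le {g : Z → E} (hg : Integrable g P) (h0 : ∫ z, g z ∂P = 0)
    {c : ℝ} (hi : Integrable (fun z => Real.exp ‖g z‖ - 1 - ‖g z‖) P)
    (hc : ∫ z, (Real.exp ‖g z‖ - 1 - ‖g z‖) ∂P ≤ c) (v : E) :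
    ∫⁻ z, ENNReal.ofReal (Real.cosh ‖v + g z‖) ∂P ≤
      ENNReal.ofReal (Real.cosh ‖v‖ * (1 + c)) := by
  have hin : Integrable (fun z => inner ℝ v (g z)) P := hg.const_inner v
  have hi1 : Integrable (fun z => Real.cosh ‖v‖ + Real.sinh ‖v‖ / ‖v‖ * inner ℝ v (g z)) P :=
    (integrable_const _).add (hin.const_mul _)
  have hi2 := hi1.add (hi.const_mul (Real.cosh ‖v‖))
  calc ∫⁻ z, ENNReal.ofReal (Real.cosh ‖v + g z‖) ∂P
      ≤ ∫⁻ z, ENNReal.ofReal ((fun z => Real.cosh ‖v‖ + Real.sinh ‖v‖ / ‖v‖ * inner ℝ v (g z)) z +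
          Real.cosh ‖v‖ * (Real.exp ‖g z‖ - 1 - ‖g z‖)) ∂P :=
        lintegral_mono fun z => ENNReal.ofReal_le_ofReal (cosh_norm_add_le v (g z))
    _ = ENNReal.ofReal (∫ z, ((fun z => Real.cosh ‖v‖ +
          Real.sinh ‖v‖ / ‖v‖ * inner ℝ v (g z)) z +
          Real.cosh ‖v‖ * (Real.exp ‖g z‖ - 1 - ‖g z‖)) ∂P) :=
        (ofReal_integral_eq_lintegral_ofReal hi2 (.of_forall fun z =>
          (Real.cosh_pos _).le.trans (cosh_norm_add_le v (g z)))).symm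
    _ ≤ _ := by
        apply ENNReal.ofReal_le_ofReal
        rw [integral_add hi1 (hi.const_mul _), integral_add (integrable_const _) (hin.const_mul _),
          integral_const_mul, integral_const_mul, integral_inner hg, h0]
        have := mul_le_mul_of_nonneg_left hc (Real.cosh_pos ‖v‖).le
        simp
        linarith

variable [MeasurableSpace E] [BorelSpace E] [SecondCountableTopology E]

/-- Induction on the sample size, integrating out one coordinate at a time. The shift `v` is general
because the integrated coordinate is absorbed into it. -/
theorem lintegral_cosh_norm_sum_le {g : Z → E} (hm : Measurable g) (hg : Integrable g P)
    (h0 : ∫ z, g z ∂P = 0) {c : ℝ} (hc0 : 0 ≤ c)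
    (hi : Integrable (fun z => Real.exp ‖g z‖ - 1 - ‖g z‖) P)
    (hc : ∫ z, (Real.exp ‖g z‖ - 1 - ‖g z‖) ∂P ≤ c) (n : ℕ) (v : E) :
    ∫⁻ S, ENNReal.ofReal (Real.cosh ‖v + ∑ i, g (S i)‖) ∂(Measure.pi fun _ : Fin n => P) ≤
      ENNReal.ofReal (Real.cosh ‖v‖ * (1 + c) ^ n) := by
  induction n generalizing v with
  | zero => simp
  | succ n ih =>
    have hmp := (measurePreserving_piFinSuccAbove (fun _ : Fin (n + 1) => P) 0).symm
    have hmeas : Measurable fun S : Fin (n + 1) → Z =>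
        ENNReal.ofReal (Real.cosh ‖v + ∑ i, g (S i)‖) := by
      have : Measurable fun S : Fin (n + 1) → Z => ∑ i, g (S i) :=
        Finset.measurable_sum _ fun i _ => hm.comp (measurable_pi_apply i)
      fun_prop
    rw [← hmp.lintegral_comp hmeas]
    refine (lintegral_prod _ (hmeas.comp hmp.measurable).aemeasurable).trans_le ?_
    calc _ = ∫⁻ z, ∫⁻ S, ENNReal.ofReal (Real.cosh ‖(v + g z) + ∑ i, g (S i)‖)
          ∂(Measure.pi fun _ : Fin n => P) ∂P := by
          refine lintegral_congr fun z => lintegral_congr fun S => ?_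
          simp [Fin.sum_univ_succ, MeasurableEquiv.piFinSuccAbove, add_assoc]
      _ ≤ ∫⁻ z, ENNReal.ofReal (Real.cosh ‖v + g z‖ * (1 + c) ^ n) ∂P :=
          lintegral_mono fun z => ih (v + g z)
      _ = (∫⁻ z, ENNReal.ofReal (Real.cosh ‖v + g z‖) ∂P) * ENNReal.ofReal ((1 + c) ^ n) := by
          rw [← lintegral_mul_const' _ _ ENNReal.ofReal_ne_top]
          exact lintegral_congr fun z => ENNReal.ofReal_mul (Real.cosh_pos _).le
      _ ≤ ENNReal.ofReal (Real.cosh ‖v‖ * (1 + c)) * ENNReal.ofReal ((1 + c) ^ n) := by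
          gcongr
          exact lintegral_cosh_norm_add_le hg h0 hi hc v
      _ = _ := by
          rw [← ENNReal.ofReal_mul (by have := Real.cosh_pos ‖v‖; positivity)]
          congr 1; ring

end Bernstein

/-! ### From moment conditions to a Bernstein tail bound for vector averages. -/

section Tail

variable {Z : Type*} [MeasurableSpace Z] {P : Measure Z}

theorem hasSum_exp_sub_one_sub (x : ℝ) :
    HasSum (fun k : ℕ => x ^ (k + 2) / (k + 2).factorial) (Real.exp x - 1 - x) := by
  have h := NormedSpace.expSeries_div_hasSum_exp (𝔸 := ℝ) x
  rw [← Real.exp_eq_exp_ℝ] at h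
  have h2 := (hasSum_nat_add_iff' 2).2 h
  have e : Real.exp x - 1 - x =
      Real.exp x - ∑ i ∈ Finset.range 2, x ^ i / (i.factorial : ℝ) := by
    simp [Finset.sum_range_succ]
    ring
  rwa [e]

theorem exp_sub_one_sub_nonneg (x : ℝ) : 0 ≤ Real.exp x - 1 - x := by
  linarith [Real.add_one_le_exp x]

theorem exp_sub_one_sub_mono {x y : ℝ} (hx : 0 ≤ x) (hxy : x ≤ y) :
    Real.exp x - 1 - x ≤ Real.exp y - 1 - y := by
  have h1 : Real.exp y = Real.exp x * Real.exp (y - x) := by rw [← Real.exp_add]; ring_nf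
  have h2 := Real.add_one_le_exp (y - x)
  have h3 := Real.one_le_exp hx
  nlinarith

theorem exp_sub_one_sub_midpoint (x y : ℝ) :
    Real.exp (x + y) - 1 - (x + y) ≤
      ((Real.exp (2 * x) - 1 - 2 * x) + (Real.exp (2 * y) - 1 - 2 * y)) / 2 := by
  have h1 : Real.exp (2 * x) = Real.exp x ^ 2 := by rw [← Real.exp_nat_mul]; norm_num
  have h2 : Real.exp (2 * y) = Real.exp y ^ 2 := by rw [← Real.exp_nat_mul]; norm_num
  rw [Real.exp_add, h1, h2]
  nlinarith [sq_nonneg (Real.exp x - Real.exp y)]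

/-- Termwise the factorials cancel and leave `t² V / 2` times a geometric series of ratio `t B ≤
1/2`. Working with the lower integral allows summation before integrability is known. -/
theorem lintegral_exp_sub_one_sub_le {u : Z → ℝ} (hu : ∀ z, 0 ≤ u z) {V B t : ℝ}
    (hV : 0 ≤ V) (hB : 0 ≤ B) (ht : 0 ≤ t) (htB : t * B ≤ 1 / 2)
    (hk : ∀ k : ℕ, 2 ≤ k → Integrable (fun z => u z ^ k) P ∧
      ∫ z, u z ^ k ∂P ≤ (k.factorial : ℝ) / 2 * V * B ^ (k - 2)) :
    ∫⁻ z, ENNReal.ofReal (Real.exp (t * u z) - 1 - t * u z) ∂P ≤ ENNReal.ofReal (t ^ 2 * V) := by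
  have hnn : ∀ (k : ℕ) z, 0 ≤ (t * u z) ^ (k + 2) / ((k + 2).factorial : ℝ) := fun k z => by
    have := hu z; positivity
  have hint : ∀ k : ℕ, Integrable (fun z => (t * u z) ^ (k + 2) / ((k + 2).factorial : ℝ)) P := by
    intro k
    simp_rw [mul_pow]
    exact ((hk (k + 2) (by omega)).1.const_mul _).div_const _
  calc ∫⁻ z, ENNReal.ofReal (Real.exp (t * u z) - 1 - t * u z) ∂P
      = ∫⁻ z, ∑' k : ℕ, ENNReal.ofReal ((t * u z) ^ (k + 2) / ((k + 2).factorial : ℝ)) ∂P := by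
        refine lintegral_congr fun z => ?_
        rw [← ENNReal.ofReal_tsum_of_nonneg (fun k => hnn k z)
          (hasSum_exp_sub_one_sub _).summable, (hasSum_exp_sub_one_sub _).tsum_eq]
    _ = ∑' k : ℕ, ∫⁻ z, ENNReal.ofReal ((t * u z) ^ (k + 2) / ((k + 2).factorial : ℝ)) ∂P :=
        lintegral_tsum fun k => (hint k).aestronglyMeasurable.aemeasurable.ennreal_ofReal
    _ ≤ ∑' k : ℕ, ENNReal.ofReal (t ^ 2 * V / 2 * (1 / 2) ^ k) := by
        refine ENNReal.tsum_le_tsum fun k => ?_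
        rw [← ofReal_integral_eq_lintegral_ofReal (hint k) (.of_forall fun z => hnn k z)]
        apply ENNReal.ofReal_le_ofReal
        simp_rw [mul_pow]
        rw [integral_div, integral_const_mul, div_le_iff₀ (by positivity)]
        calc t ^ (k + 2) * ∫ z, u z ^ (k + 2) ∂P
            ≤ t ^ (k + 2) * (((k + 2).factorial : ℝ) / 2 * V * B ^ k) := by
              gcongr
              exact (hk (k + 2) (by omega)).2
          _ = t ^ 2 * V / 2 * (t * B) ^ k * (k + 2).factorial := by ring
          _ ≤ _ := by gcongr
    _ = ENNReal.ofReal (t ^ 2 * V) := by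
        rw [← ENNReal.ofReal_tsum_of_nonneg (fun k => by positivity)
          (summable_geometric_two.mul_left _), tsum_mul_left, tsum_geometric_two]
        congr 1; ring

theorem integrable_and_integral_le_of_lintegral_le {φ : Z → ℝ} (hm : AEStronglyMeasurable φ P)
    (h0 : ∀ z, 0 ≤ φ z) {c : ℝ} (hc : 0 ≤ c)
    (h : ∫⁻ z, ENNReal.ofReal (φ z) ∂P ≤ ENNReal.ofReal c) :
    Integrable φ P ∧ ∫ z, φ z ∂P ≤ c := by
  constructor
  · refine ⟨hm, ?_⟩
    rw [hasFiniteIntegral_iff_ofReal (.of_forall h0)]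
    exact h.trans_lt ENNReal.ofReal_lt_top
  · rw [integral_eq_lintegral_of_nonneg_ae (.of_forall h0) hm]
    exact ENNReal.toReal_le_of_le_ofReal hc h

variable {d : ℕ} [IsProbabilityMeasure P]

theorem BernsteinCondition.integrable {g : Z → Vec d} {B : ℝ} (h : BernsteinCondition P g B) :
    Integrable g P := by
  refine ((integrable_const (1 : ℝ)).add (h.2 2 le_rfl).1).mono' h.1 (.of_forall fun z => ?_)
  simp only [Pi.add_apply]
  nlinarith [sq_nonneg (‖g z‖ - 1)]

theorem BernsteinCondition.norm_integral_le {g : Z → Vec d} {B : ℝ}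
    (h : BernsteinCondition P g B) :
    ‖∫ z, g z ∂P‖ ≤ (1 + ∫ z, ‖g z‖ ^ 2 ∂P) / 2 := by
  calc ‖∫ z, g z ∂P‖ ≤ ∫ z, (1 + ‖g z‖ ^ 2) / 2 ∂P := by
        refine norm_integral_le_of_norm_le
          (((integrable_const (1 : ℝ)).add (h.2 2 le_rfl).1).div_const 2) (.of_forall fun z => ?_)
        nlinarith [sq_nonneg (‖g z‖ - 1)]
    _ = _ := by
        rw [integral_div, integral_add (integrable_const _) (h.2 2 le_rfl).1]
        simp

/-- Centering is paid for by doubling `t`: `‖g - G‖ ≤ ‖g‖ + ‖G‖`, the function `exp x - 1 - x` is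
midpoint convex, and Jensen's inequality bounds its value at `2t‖G‖` by the moment of `2t‖g‖`. -/
theorem BernsteinCondition.centered_exp_moment {g : Z → Vec d} {B t : ℝ}
    (h : BernsteinCondition P g B) (hB : 0 ≤ B) (ht : 0 ≤ t) (htB : t * B ≤ 1 / 4) :
    Integrable (fun z => Real.exp ‖t • (g z - ∫ z, g z ∂P)‖ - 1 - ‖t • (g z - ∫ z, g z ∂P)‖) P ∧
      ∫ z, (Real.exp ‖t • (g z - ∫ z, g z ∂P)‖ - 1 - ‖t • (g z - ∫ z, g z ∂P)‖) ∂P ≤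
        4 * t ^ 2 * ∫ z, ‖g z‖ ^ 2 ∂P := by
  set G := ∫ z, g z ∂P with hG
  set V := ∫ z, ‖g z‖ ^ 2 ∂P with hVdef
  have hV : 0 ≤ V := integral_nonneg fun z => by positivity
  have hgm := h.1
  obtain ⟨i1, l1⟩ := integrable_and_integral_le_of_lintegral_le
    (φ := fun z => Real.exp (2 * t * ‖g z‖) - 1 - 2 * t * ‖g z‖)
    (by
      have := hgm.norm.const_mul (2 * t)
      exact ((Real.continuous_exp.comp_aestronglyMeasurable this).sub
        aestronglyMeasurable_const).sub this)
    (fun z => exp_sub_one_sub_nonneg _) (c := (2 * t) ^ 2 * V) (by positivity)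
    (lintegral_exp_sub_one_sub_le (fun z => norm_nonneg _) hV hB (by positivity)
      (by linarith) h.2)
  have hn : Integrable (fun z => ‖g z‖) P := h.integrable.norm
  have hn2 := hn.const_mul (2 * t)
  have iexp : Integrable (fun z => Real.exp (2 * t * ‖g z‖)) P := by
    refine ((i1.add (integrable_const (1 : ℝ))).add hn2).congr (.of_forall fun z => ?_)
    simp only [Pi.add_apply]
    ring
  have hG2 : Real.exp (2 * (t * ‖G‖)) - 1 - 2 * (t * ‖G‖) ≤ (2 * t) ^ 2 * V := by
    refine le_trans ?_ l1
    have hGn : ‖G‖ ≤ ∫ z, ‖g z‖ ∂P := norm_integral_le_integral_norm _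
    have hj : Real.exp (∫ z, 2 * t * ‖g z‖ ∂P) ≤ ∫ z, Real.exp (2 * t * ‖g z‖) ∂P :=
      convexOn_exp.map_integral_le Real.continuous_exp.continuousOn isClosed_univ
        (.of_forall fun _ => Set.mem_univ _) hn2 iexp
    have e : ∫ z, (Real.exp (2 * t * ‖g z‖) - 1 - 2 * t * ‖g z‖) ∂P =
        ∫ z, Real.exp (2 * t * ‖g z‖) ∂P - 1 - 2 * t * ∫ z, ‖g z‖ ∂P := by
      have e1 := integral_sub (iexp.sub (integrable_const (1 : ℝ))) hn2
      have e2 := integral_sub iexp (integrable_const (1 : ℝ))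
      simp only [Pi.sub_apply] at e1 e2
      rw [e1, e2, integral_const_mul]
      simp
    rw [e]
    rw [integral_const_mul] at hj
    refine (exp_sub_one_sub_mono (by positivity)
      (by rw [← mul_assoc]; gcongr : 2 * (t * ‖G‖) ≤ 2 * t * ∫ z, ‖g z‖ ∂P)).trans ?_
    linarith
  have hpt : ∀ z, Real.exp ‖t • (g z - G)‖ - 1 - ‖t • (g z - G)‖ ≤
      ((Real.exp (2 * t * ‖g z‖) - 1 - 2 * t * ‖g z‖) + (2 * t) ^ 2 * V) / 2 := fun z => by
    have h1 : ‖t • (g z - G)‖ ≤ t * ‖g z‖ + t * ‖G‖ := by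
      rw [norm_smul, Real.norm_of_nonneg ht, ← mul_add]
      gcongr
      exact norm_sub_le _ _
    have h2 := exp_sub_one_sub_mono (norm_nonneg _) h1
    have h3 := exp_sub_one_sub_midpoint (t * ‖g z‖) (t * ‖G‖)
    rw [← mul_assoc 2 t ‖g z‖] at h3
    linarith
  have ib : Integrable (fun z => ((Real.exp (2 * t * ‖g z‖) - 1 - 2 * t * ‖g z‖) +
      (2 * t) ^ 2 * V) / 2) P := (i1.add (integrable_const _)).div_const 2
  have hm : AEStronglyMeasurable
      (fun z => Real.exp ‖t • (g z - G)‖ - 1 - ‖t • (g z - G)‖) P := by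
    have := ((hgm.sub (aestronglyMeasurable_const (b := G))).const_smul t).norm
    exact ((Real.continuous_exp.comp_aestronglyMeasurable this).sub
        aestronglyMeasurable_const).sub this
  have ii : Integrable (fun z => Real.exp ‖t • (g z - G)‖ - 1 - ‖t • (g z - G)‖) P := by
    refine ib.mono' hm (.of_forall fun z => ?_)
    rw [Real.norm_of_nonneg (exp_sub_one_sub_nonneg _)]
    exact hpt z
  refine ⟨ii, (integral_mono ii ib hpt).trans ?_⟩
  rw [integral_div, integral_add i1 (integrable_const _)]
  simp only [integral_const, probReal_univ, smul_eq_mul, one_mul]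
  linarith

/-- A Chernoff bound with `cosh` in place of `exp`: on the event the integrand is at least `exp (2ℓ)
/ 2`, while its integral is at most `exp ℓ`. -/
theorem BernsteinCondition.measure_norm_sum_ge_le {g : Z → Vec d} (hgm : Measurable g) {B ℓ : ℝ}
    (h : BernsteinCondition P g B) (hB : 0 < B) (hℓ : 0 < ℓ) (n : ℕ) :
    Measure.pi (fun _ : Fin n => P)
      {S | 2 * ℓ * (4 * B + √(4 * n * (∫ z, ‖g z‖ ^ 2 ∂P) / ℓ)) ≤
        ‖∑ i, (g (S i) - ∫ z, g z ∂P)‖} ≤ ENNReal.ofReal (2 * Real.exp (-ℓ)) := by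
  set V := ∫ z, ‖g z‖ ^ 2 ∂P with hVdef
  have hV : 0 ≤ V := integral_nonneg fun z => by positivity
  set q := √(4 * n * V / ℓ) with hq
  have hq0 : 0 ≤ q := Real.sqrt_nonneg _
  have hq2 : q ^ 2 * ℓ = 4 * n * V := by
    rw [hq, Real.sq_sqrt (by positivity)]; field_simp
  set D := 4 * B + q with hD
  have hD0 : 0 < D := by positivity
  set t := 1 / D with ht
  have ht0 : 0 < t := by positivity
  have htD : t * D = 1 := by rw [ht]; field_simp
  obtain ⟨i1, l1⟩ := h.centered_exp_moment hB.le ht0.le (by nlinarith)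
  set G := ∫ z, g z ∂P with hG
  have hX : Integrable (fun z => t • (g z - G)) P :=
    (h.integrable.sub (integrable_const _)).smul t
  have hX0 : ∫ z, t • (g z - G) ∂P = 0 := by
    rw [integral_smul, integral_sub h.integrable (integrable_const _)]
    simp [hG]
  have hmain := lintegral_cosh_norm_sum_le (P := P) (g := fun z => t • (g z - G))
    (by fun_prop) hX hX0 (by positivity) i1 l1 n 0
  simp only [zero_add, norm_zero, Real.cosh_zero, one_mul] at hmain
  set A := {S : Fin n → Z | 2 * ℓ * D ≤ ‖∑ i, (g (S i) - G)‖} with hA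
  have hAm : MeasurableSet A := by
    have : Measurable fun S : Fin n → Z => ∑ i, (g (S i) - G) :=
      Finset.measurable_sum _ fun i _ => (hgm.comp (measurable_pi_apply i)).sub measurable_const
    exact measurableSet_le measurable_const this.norm
  have hlow : ENNReal.ofReal (Real.exp (2 * ℓ) / 2) * Measure.pi (fun _ : Fin n => P) A ≤
      ENNReal.ofReal ((1 + 4 * t ^ 2 * V) ^ n) := by
    refine le_trans ?_ hmain
    rw [← setLIntegral_const]
    refine (setLIntegral_mono' hAm fun S hS => ?_).trans (setLIntegral_le_lintegral _ _)
    apply ENNReal.ofReal_le_ofReal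
    rw [← Finset.smul_sum, norm_smul, Real.norm_of_nonneg ht0.le]
    have h1 : 2 * ℓ ≤ t * ‖∑ i, (g (S i) - G)‖ := by
      have h3 : 2 * ℓ * D ≤ ‖∑ i, (g (S i) - G)‖ := by rwa [hA, Set.mem_ofPred_eq] at hS
      calc 2 * ℓ = t * (2 * ℓ * D) := by rw [mul_left_comm, htD, mul_one]
        _ ≤ _ := mul_le_mul_of_nonneg_left h3 ht0.le
    rw [Real.cosh_eq]
    have h2 := Real.exp_le_exp.2 h1
    have h3 := Real.exp_pos (-(t * ‖∑ i, (g (S i) - G)‖))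
    linarith
  have hexp : (1 + 4 * t ^ 2 * V) ^ n ≤ Real.exp ℓ := by
    calc (1 + 4 * t ^ 2 * V) ^ n ≤ Real.exp (4 * t ^ 2 * V) ^ n := by
          gcongr; linarith [Real.add_one_le_exp (4 * t ^ 2 * V)]
      _ = Real.exp (t ^ 2 * (4 * n * V)) := by rw [← Real.exp_nat_mul]; congr 1; ring
      _ ≤ Real.exp ℓ := by
          apply Real.exp_le_exp.2
          rw [← hq2, ← mul_assoc, ← mul_pow]
          have : t * q ≤ 1 := by rw [← htD]; gcongr; linarith
          have h0 : 0 ≤ t * q := by positivity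
          have : (t * q) ^ 2 ≤ 1 := by nlinarith
          nlinarith
  have hfin := hlow.trans (ENNReal.ofReal_le_ofReal hexp)
  rw [mul_comm, ← ENNReal.le_div_iff_mul_le (Or.inl (by simp; positivity))
    (Or.inl ENNReal.ofReal_ne_top)] at hfin
  refine hfin.trans_eq ?_
  rw [← ENNReal.ofReal_div_of_pos (by positivity)]
  congr 1
  rw [Real.exp_neg, show 2 * ℓ = ℓ + ℓ by ring, Real.exp_add]
  field_simp

theorem BernsteinCondition.exists_event {g : Z → Vec d} {B δ : ℝ}
    (h : BernsteinCondition P g B) (hB : 0 < B) (hδ : 0 < δ) (hδ1 : δ < 1) {n : ℕ} (hn : 0 < n) :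
    ∃ A : Set (Fin n → Z), MeasurableSet A ∧
      Measure.pi (fun _ : Fin n => P) Aᶜ ≤ ENNReal.ofReal (δ / 4) ∧
      ∀ S ∈ A, ‖(1 / (n : ℝ)) • ∑ i, g (S i) - ∫ z, g z ∂P‖ ^ 2 ≤
        128 * B ^ 2 * (Real.log (8 / δ) / n) ^ 2 +
          32 * (∫ z, ‖g z‖ ^ 2 ∂P) * (Real.log (8 / δ) / n) := by
  -- `g` is only almost everywhere measurable: the tail bound is applied to a measurable version,
  -- and the samples on which the two differ are discarded as a null set.
  obtain ⟨g', hg', hae⟩ := h.1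
  have hkk : ∀ k : ℕ, (fun z => ‖g z‖ ^ k) =ᵐ[P] fun z => ‖g' z‖ ^ k := fun k => by
    filter_upwards [hae] with z hz; rw [hz]
  have hV : ∫ z, ‖g z‖ ^ 2 ∂P = ∫ z, ‖g' z‖ ^ 2 ∂P := integral_congr_ae (hkk 2)
  have hb' : BernsteinCondition P g' B := by
    refine ⟨hg'.aestronglyMeasurable, fun k hk => ⟨(h.2 k hk).1.congr (hkk k), ?_⟩⟩
    rw [← hV, ← integral_congr_ae (hkk k)]
    exact (h.2 k hk).2
  have hℓ : 0 < Real.log (8 / δ) := Real.log_pos (by rw [lt_div_iff₀ hδ]; linarith)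
  set ℓ := Real.log (8 / δ) with hℓd
  have htail := hb'.measure_norm_sum_ge_le hg'.measurable hB hℓ n
  rw [hV, integral_congr_ae hae]
  set V := ∫ z, ‖g' z‖ ^ 2 ∂P with hVd
  have hV0 : 0 ≤ V := integral_nonneg fun z => by positivity
  set G := ∫ z, g' z ∂P with hG
  set r := 2 * ℓ * (4 * B + √(4 * n * V / ℓ)) with hr
  set N := {S : Fin n → Z | r ≤ ‖∑ i, (g' (S i) - G)‖} with hN
  set N' := {S : Fin n → Z | ¬ ∀ i, g (S i) = g' (S i)} with hN'
  have hN'0 : Measure.pi (fun _ : Fin n => P) N' = 0 := by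
    have : ∀ᵐ S ∂(Measure.pi fun _ : Fin n => P), ∀ i, g (S i) = g' (S i) :=
      Filter.eventually_all.2 fun i =>
        (Measure.tendsto_eval_ae_ae (μ := fun _ : Fin n => P) (i := i)).eventually hae
    exact this
  refine ⟨(toMeasurable (Measure.pi fun _ : Fin n => P) (N ∪ N'))ᶜ,
    (measurableSet_toMeasurable _ _).compl, ?_, fun S hS => ?_⟩
  · rw [compl_compl, measure_toMeasurable]
    refine (measure_union_le _ _).trans ?_
    rw [hN'0, add_zero]
    refine htail.trans (ENNReal.ofReal_le_ofReal ?_)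
    rw [Real.exp_neg, hℓd, Real.exp_log (by positivity)]
    apply le_of_eq; field_simp; norm_num
  · have hS' : S ∉ N ∪ N' := fun hh => hS (subset_toMeasurable _ _ hh)
    simp only [Set.mem_union, not_or, hN, hN', Set.mem_ofPred_eq, not_le, not_not] at hS'
    obtain ⟨h1, h2⟩ := hS'
    have hn' : (0 : ℝ) < n := by exact_mod_cast hn
    have heq : (1 / (n : ℝ)) • ∑ i, g (S i) - G = (1 / (n : ℝ)) • ∑ i, (g' (S i) - G) := by
      simp only [h2, Finset.sum_sub_distrib, smul_sub, Finset.sum_const, Finset.card_univ,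
        Fintype.card_fin]
      rw [← Nat.cast_smul_eq_nsmul ℝ, smul_smul, one_div, inv_mul_cancel₀ hn'.ne', one_smul]
    rw [heq, norm_smul, Real.norm_of_nonneg (by positivity), mul_pow]
    have hsq : ‖∑ i, (g' (S i) - G)‖ ^ 2 ≤ r ^ 2 := by gcongr
    have hr2 : r ^ 2 ≤ 4 * ℓ ^ 2 * (2 * (4 * B) ^ 2 + 2 * (4 * n * V / ℓ)) := by
      rw [hr, mul_pow]
      have hq2 : √(4 * n * V / ℓ) ^ 2 = 4 * n * V / ℓ := Real.sq_sqrt (by positivity)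
      have := sq_nonneg (4 * B - √(4 * n * V / ℓ))
      rw [show (2 * ℓ) ^ 2 = 4 * ℓ ^ 2 by ring]
      gcongr
      nlinarith
    calc (1 / (n : ℝ)) ^ 2 * ‖∑ i, (g' (S i) - G)‖ ^ 2
        ≤ (1 / (n : ℝ)) ^ 2 * (4 * ℓ ^ 2 * (2 * (4 * B) ^ 2 + 2 * (4 * n * V / ℓ))) := by
          gcongr; exact hsq.trans hr2
      _ = _ := by field_simp; ring

end Tail

/-! ### One step of gradient descent ascent for a deterministic saddle function. -/

section Saddle

variable {E E' : Type*} [NormedAddCommGroup E] [InnerProductSpace ℝ E]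
  [NormedAddCommGroup E'] [InnerProductSpace ℝ E']

/-- `F` is strongly convex in `x ∈ X` and strongly concave in `y ∈ Y` with partial gradients
`gx` and `gy`, which are Lipschitz and satisfy the quadratic bounds of a smooth function. -/
structure IsSaddleFunction (β μx μy : ℝ) (X : Set E) (Y : Set E') (F : E → E' → ℝ)
    (gx : E → E' → E) (gy : E → E' → E') : Prop where
  strong_x : ∀ x ∈ X, ∀ x' ∈ X, ∀ y ∈ Y,
    inner ℝ (gx x y) (x' - x) + μx / 2 * ‖x' - x‖ ^ 2 ≤ F x' y - F x y
  strong_y : ∀ x ∈ X, ∀ y ∈ Y, ∀ y' ∈ Y,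
    F x y' - F x y ≤ inner ℝ (gy x y) (y' - y) - μy / 2 * ‖y' - y‖ ^ 2
  smooth_x : ∀ x ∈ X, ∀ x' ∈ X, ∀ y ∈ Y,
    F x' y - F x y ≤ inner ℝ (gx x y) (x' - x) + β / 2 * ‖x' - x‖ ^ 2
  smooth_y : ∀ x ∈ X, ∀ y ∈ Y, ∀ y' ∈ Y,
    inner ℝ (gy x y) (y' - y) - β / 2 * ‖y' - y‖ ^ 2 ≤ F x y' - F x y
  lip_x : ∀ x ∈ X, ∀ x' ∈ X, ∀ y ∈ Y, ∀ y' ∈ Y,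
    ‖gx x y - gx x' y'‖ ≤ β * (‖x - x'‖ + ‖y - y'‖)
  lip_y : ∀ x ∈ X, ∀ x' ∈ X, ∀ y ∈ Y, ∀ y' ∈ Y,
    ‖gy x y - gy x' y'‖ ≤ β * (‖x - x'‖ + ‖y - y'‖)

/-- Divide by `s` and let `s → 0`. This turns optimality along segments into first-order variational
inequalities. -/
theorem nonpos_of_mul_le_sq_mul {a b : ℝ} (h : ∀ s : ℝ, 0 < s → s ≤ 1 → s * a ≤ s ^ 2 * b) :
    a ≤ 0 := by
  by_contra! ha
  have hb : a ≤ b := by simpa using h 1 one_pos le_rfl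
  have hb0 : 0 < b := ha.trans_le hb
  have h1 := h (a / (2 * b)) (by positivity) (by rw [div_le_one (by positivity)]; linarith)
  have h2 : a / (2 * b) * a = a ^ 2 / (2 * b) := by ring
  have h3 : (a / (2 * b)) ^ 2 * b = a ^ 2 / (2 * b) / 2 := by field_simp
  rw [h2, h3] at h1
  have : 0 < a ^ 2 / (2 * b) := by positivity
  linarith

namespace IsSaddleFunction

variable {β μx μy : ℝ} {X : Set E} {Y : Set E'} {F : E → E' → ℝ}
  {gx : E → E' → E} {gy : E → E' → E'}

/-- Nothing forces `μy ≤ β`, for instance when `Y` is a single point, so later steps use `min μy β`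
as the concavity constant. -/
theorem mono (h : IsSaddleFunction β μx μy X Y F gx gy) {μ : ℝ} (hμ : μ ≤ μy) :
    IsSaddleFunction β μx μ X Y F gx gy where
  strong_x := h.strong_x
  strong_y x hx y hy y' hy' := (h.strong_y x hx y hy y' hy').trans (by gcongr)
  smooth_x := h.smooth_x
  smooth_y := h.smooth_y
  lip_x := h.lip_x
  lip_y := h.lip_y

theorem monotone (h : IsSaddleFunction β μx μy X Y F gx gy) {x x' : E} {y y' : E'} (hx : x ∈ X)
    (hx' : x' ∈ X) (hy : y ∈ Y) (hy' : y' ∈ Y) :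
    μx * ‖x - x'‖ ^ 2 + μy * ‖y - y'‖ ^ 2 ≤
      inner ℝ (gx x y - gx x' y') (x - x') - inner ℝ (gy x y - gy x' y') (y - y') := by
  have h1 := h.strong_x x hx x' hx' y hy
  have h2 := h.strong_x x' hx' x hx y' hy'
  have h3 := h.strong_y x hx y hy y' hy'
  have h4 := h.strong_y x' hx' y' hy' y hy
  rw [← neg_sub x x', inner_neg_right, norm_neg] at h1
  rw [← neg_sub y y', inner_neg_right, norm_neg] at h3
  rw [inner_sub_left, inner_sub_left]
  linarith

theorem continuousOn_right (h : IsSaddleFunction β μx μy X Y F gx gy) {x : E} (hx : x ∈ X) :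
    ContinuousOn (F x) Y := by
  intro y hy
  have hc : ∀ c : ℝ, Filter.Tendsto
      (fun y' => F x y + (inner ℝ (gy x y) (y' - y) - c / 2 * ‖y' - y‖ ^ 2))
      (nhdsWithin y Y) (nhds (F x y)) := fun c => by
    have : Continuous fun y' => F x y + (inner ℝ (gy x y) (y' - y) - c / 2 * ‖y' - y‖ ^ 2) := by
      fun_prop
    simpa using (this.tendsto y).mono_left nhdsWithin_le_nhds
  refine tendsto_of_tendsto_of_tendsto_of_le_of_le' (hc β) (hc μy) ?_ ?_
  · filter_upwards [self_mem_nhdsWithin] with y' hy'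
    linarith [h.smooth_y x hx y hy y' hy']
  · filter_upwards [self_mem_nhdsWithin] with y' hy'
    linarith [h.strong_y x hx y hy y' hy']

theorem inner_le_zero_of_isMaxOn (h : IsSaddleFunction β μx μy X Y F gx gy) (hY : Convex ℝ Y)
    {x : E} (hx : x ∈ X) {ŷ y : E'} (hŷ : ŷ ∈ Y) (hm : IsMaxOn (F x) Y ŷ) (hy : y ∈ Y) :
    inner ℝ (gy x ŷ) (y - ŷ) ≤ 0 := by
  refine nonpos_of_mul_le_sq_mul (b := β / 2 * ‖y - ŷ‖ ^ 2) fun s hs hs1 => ?_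
  have hmem : ŷ + s • (y - ŷ) ∈ Y := hY.add_smul_sub_mem hŷ hy ⟨hs.le, hs1⟩
  have h1 := h.smooth_y x hx ŷ hŷ _ hmem
  have h2 : F x (ŷ + s • (y - ŷ)) ≤ F x ŷ := hm hmem
  rw [add_sub_cancel_left, inner_smul_right, norm_smul, mul_pow, Real.norm_of_nonneg hs.le] at h1
  linarith

/-- The best response is `β / μy`-Lipschitz: the variational inequalities at the two maximizers are
added to the strong monotonicity of the gradient in `y`. -/
theorem mul_norm_argmax_sub_le (h : IsSaddleFunction β μx μy X Y F gx gy) (hY : Convex ℝ Y)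
    {x x' : E} (hx : x ∈ X) (hx' : x' ∈ X) {ŷ ŷ' : E'} (hŷ : ŷ ∈ Y) (hm : IsMaxOn (F x) Y ŷ)
    (hŷ' : ŷ' ∈ Y) (hm' : IsMaxOn (F x') Y ŷ') : μy * ‖ŷ - ŷ'‖ ≤ β * ‖x - x'‖ := by
  have h1 := h.inner_le_zero_of_isMaxOn hY hx hŷ hm hŷ'
  have h2 := h.inner_le_zero_of_isMaxOn hY hx' hŷ' hm' hŷ
  have h3 := h.monotone hx' hx' hŷ hŷ'
  have h4 := h.lip_y x hx x' hx' ŷ hŷ ŷ hŷ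
  have h5 := real_inner_le_norm (gy x ŷ - gy x' ŷ) (ŷ - ŷ')
  rw [← neg_sub ŷ ŷ', inner_neg_right] at h1
  simp only [sub_self, norm_zero, inner_zero_right, add_zero] at h3 h4
  rw [inner_sub_left] at h3 h5
  rcases (norm_nonneg (ŷ - ŷ')).eq_or_lt with h0 | h0
  · rw [← h0, mul_zero]
    exact (norm_nonneg _).trans h4
  · refine le_of_mul_le_mul_right ?_ h0
    nlinarith [mul_le_mul_of_nonneg_right h4 h0.le]

/-- Moving the `y`-gradient from `x'` to `x` costs `β ‖x' - x‖ ‖y - ŷ‖`. Young's inequality absorbs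
the `y` part into the strong concavity, so only a quadratic term in `x' - x` is left. -/
theorem le_add_inner_add_inner (h : IsSaddleFunction β μx μy X Y F gx gy)
    (hμ : 0 < μy) {x x' : E} (hx : x ∈ X) (hx' : x' ∈ X) {ŷ y : E'} (hŷ : ŷ ∈ Y) (hy : y ∈ Y) :
    F x' y ≤ F x ŷ + inner ℝ (gx x ŷ) (x' - x) + inner ℝ (gy x ŷ) (y - ŷ) +
      (β + β ^ 2 / μy) / 2 * ‖x' - x‖ ^ 2 := by
  have h2 := h.strong_y x' hx' ŷ hŷ y hy
  have h3 := h.smooth_x x hx x' hx' ŷ hŷ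
  have h4 := h.lip_y x' hx' x hx ŷ hŷ ŷ hŷ
  have h5 := real_inner_le_norm (gy x' ŷ - gy x ŷ) (y - ŷ)
  simp only [sub_self, norm_zero, add_zero] at h4
  rw [inner_sub_left] at h5
  have h6 := mul_le_mul_of_nonneg_right h4 (norm_nonneg (y - ŷ))
  have h7 : β * ‖x' - x‖ * ‖y - ŷ‖ ≤ μy / 2 * ‖y - ŷ‖ ^ 2 + β ^ 2 / μy / 2 * ‖x' - x‖ ^ 2 := by
    have h8 : 0 ≤ (μy * ‖y - ŷ‖ - β * ‖x' - x‖) ^ 2 / (2 * μy) := by positivity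
    have h9 : (μy * ‖y - ŷ‖ - β * ‖x' - x‖) ^ 2 / (2 * μy) =
      μy / 2 * ‖y - ŷ‖ ^ 2 + β ^ 2 / μy / 2 * ‖x' - x‖ ^ 2 - β * ‖x' - x‖ * ‖y - ŷ‖ := by
      field_simp; ring
    linarith
  linarith

theorem le_of_isMaxOn (h : IsSaddleFunction β μx μy X Y F gx gy) (hY : Convex ℝ Y)
    (hμ : 0 < μy) {x x' : E} (hx : x ∈ X) (hx' : x' ∈ X) {ŷ y : E'} (hŷ : ŷ ∈ Y)
    (hm : IsMaxOn (F x) Y ŷ) (hy : y ∈ Y) :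
    F x' y ≤ F x ŷ + inner ℝ (gx x ŷ) (x' - x) + (β + β ^ 2 / μy) / 2 * ‖x' - x‖ ^ 2 := by
  linarith [h.inner_le_zero_of_isMaxOn hY hx hŷ hm hy,
    h.le_add_inner_add_inner hμ hx hx' hŷ hy]

/-- A Polyak-Łojasiewicz inequality for the primal function, whose gradient is represented by `gx x
ŷ`. -/
theorem sub_le_of_isMaxOn (h : IsSaddleFunction β μx μy X Y F gx gy) (hμ : 0 < μx)
    {x x' : E} (hx : x ∈ X) (hx' : x' ∈ X) {ŷ ŷ' : E'} (hŷ : ŷ ∈ Y)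
    (hm' : IsMaxOn (F x') Y ŷ') : F x ŷ - F x' ŷ' ≤ ‖gx x ŷ‖ ^ 2 / (2 * μx) := by
  have h1 := h.strong_x x hx x' hx' ŷ hŷ
  have h2 : F x' ŷ ≤ F x' ŷ' := hm' hŷ
  have h3 := neg_le_of_abs_le (abs_real_inner_le_norm (gx x ŷ) (x' - x))
  have h4 : ‖gx x ŷ‖ * ‖x' - x‖ ≤ μx / 2 * ‖x' - x‖ ^ 2 + ‖gx x ŷ‖ ^ 2 / (2 * μx) := by
    have h8 : 0 ≤ (μx * ‖x' - x‖ - ‖gx x ŷ‖) ^ 2 / (2 * μx) := by positivity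
    have h9 : (μx * ‖x' - x‖ - ‖gx x ŷ‖) ^ 2 / (2 * μx) =
      μx / 2 * ‖x' - x‖ ^ 2 + ‖gx x ŷ‖ ^ 2 / (2 * μx) - ‖gx x ŷ‖ * ‖x' - x‖ := by
      field_simp; ring
    linarith
  linarith

/-- The ascent step is not projected. As it lands in `Y`, its value is at most the maximum, and this
cancels the squared-gradient term of the expansion. -/
theorem norm_ascent_sub_sq_le (h : IsSaddleFunction β μx μy X Y F gx gy) (hβ : 0 < β)
    {x : E} (hx : x ∈ X) {y ŷ : E'} (hy : y ∈ Y) (hy' : y + (1 / β) • gy x y ∈ Y)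
    (hŷ : ŷ ∈ Y) (hm : IsMaxOn (F x) Y ŷ) :
    ‖y + (1 / β) • gy x y - ŷ‖ ^ 2 ≤ (1 - μy / β) * ‖y - ŷ‖ ^ 2 := by
  have h1 := h.strong_y x hx y hy ŷ hŷ
  have h2 := h.smooth_y x hx y hy _ hy'
  have h3 : F x (y + (1 / β) • gy x y) ≤ F x ŷ := hm hy'
  rw [add_sub_cancel_left, inner_smul_right, real_inner_self_eq_norm_sq, norm_smul, mul_pow,
    Real.norm_of_nonneg (by positivity)] at h2
  rw [← neg_sub y ŷ, inner_neg_right, norm_neg] at h1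
  rw [add_sub_right_comm, norm_add_sq_real, inner_smul_right, norm_smul, mul_pow,
    Real.norm_of_nonneg (by positivity), real_inner_comm]
  have e1 : β / 2 * ((1 / β) ^ 2 * ‖gy x y‖ ^ 2) = (1 / β) * ‖gy x y‖ ^ 2 / 2 := by field_simp
  have h4 : (1 / β) * ‖gy x y‖ ^ 2 / 2 + inner ℝ (gy x y) (y - ŷ) + μy / 2 * ‖y - ŷ‖ ^ 2 ≤ 0 := by
    linarith
  have h5 := mul_le_mul_of_nonneg_left h4 (show 0 ≤ 2 / β by positivity)
  have e2 : 2 / β * ((1 / β) * ‖gy x y‖ ^ 2 / 2 + inner ℝ (gy x y) (y - ŷ) +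
      μy / 2 * ‖y - ŷ‖ ^ 2) = (1 / β) ^ 2 * ‖gy x y‖ ^ 2 + 2 * ((1 / β) * inner ℝ (gy x y) (y - ŷ))
      + μy / β * ‖y - ŷ‖ ^ 2 := by ring
  linarith

/-- Inexact gradient descent on the primal function: the step uses the gradient at `y` instead of
`ŷ`, an error of at most `β ‖y - ŷ‖`. -/
theorem descent_step_le (h : IsSaddleFunction β μx μy X Y F gx gy) (hY : Convex ℝ Y)
    (hμ : 0 < μy) {η : ℝ} (hη : 0 < η) {x : E} (hx : x ∈ X) {y ŷ y' : E'} (hy : y ∈ Y)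
    (hx' : x - η • gx x y ∈ X) (hŷ : ŷ ∈ Y) (hm : IsMaxOn (F x) Y ŷ) (hy' : y' ∈ Y) :
    F (x - η • gx x y) y' ≤ F x ŷ -
      (1 / (2 * η) - (β + β ^ 2 / μy) / 2) * (η * ‖gx x y‖) ^ 2 + η * β ^ 2 / 2 * ‖y - ŷ‖ ^ 2 := by
  have h1 := h.le_of_isMaxOn hY hμ hx hx' hŷ hm hy'
  rw [sub_sub_cancel_left, norm_neg, inner_neg_right, inner_smul_right, norm_smul,
    Real.norm_of_nonneg hη.le] at h1
  have h2 := h.lip_x x hx x hx y hy ŷ hŷ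
  simp only [sub_self, norm_zero, zero_add] at h2
  have h3 := real_inner_le_norm (gx x y - gx x ŷ) (gx x y)
  rw [inner_sub_left, real_inner_self_eq_norm_sq] at h3
  have h4 := mul_le_mul_of_nonneg_right h2 (norm_nonneg (gx x y))
  have h5 : 0 ≤ η * (‖gx x y‖ - β * ‖y - ŷ‖) ^ 2 := by positivity
  have h6 : η * (‖gx x y‖ ^ 2 - inner ℝ (gx x ŷ) (gx x y)) ≤
      η * (β * ‖y - ŷ‖ * ‖gx x y‖) := by gcongr; linarith
  have e : 1 / (2 * η) * (η * ‖gx x y‖) ^ 2 = η * ‖gx x y‖ ^ 2 / 2 := by field_simp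
  rw [sub_mul, e]
  nlinarith

/-- With `κ = β / μy`, ascent contracts the squared distance by `1 - 1/κ` and the target moves by at
most `κ ‖x - x'‖`. Young's inequality with weight `1/(2κ)` spends half of the contraction on this
drift. -/
theorem tracking_step_le (h : IsSaddleFunction β μx μy X Y F gx gy) (hY : Convex ℝ Y)
    (hβ : 0 < β) (hμ : 0 < μy) (hμβ : μy ≤ β) {x x' : E} (hx : x ∈ X) (hx' : x' ∈ X)
    {y ŷ ŷ' : E'} (hy : y ∈ Y) (hy' : y + (1 / β) • gy x y ∈ Y) (hŷ : ŷ ∈ Y)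
    (hm : IsMaxOn (F x) Y ŷ) (hŷ' : ŷ' ∈ Y) (hm' : IsMaxOn (F x') Y ŷ') :
    ‖y + (1 / β) • gy x y - ŷ'‖ ^ 2 ≤
      (1 - 1 / (2 * (β / μy))) * ‖y - ŷ‖ ^ 2 + 3 * (β / μy) ^ 3 * ‖x - x'‖ ^ 2 := by
  have h1 := h.norm_ascent_sub_sq_le hβ hx hy hy' hŷ hm
  have h2 := h.mul_norm_argmax_sub_le hY hx hx' hŷ hm hŷ' hm'
  set κ := β / μy with hκ
  have hκ1 : 1 ≤ κ := by rw [hκ, one_le_div hμ]; exact hμβ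
  have hκ0 : 0 < κ := by positivity
  have h2' : ‖ŷ - ŷ'‖ ≤ κ * ‖x - x'‖ := by
    rw [hκ, div_mul_eq_mul_div, le_div_iff₀ hμ]; linarith
  have e1 : μy / β = 1 / κ := by rw [hκ]; field_simp
  rw [e1] at h1
  set p := ‖y + (1 / β) • gy x y - ŷ‖
  have h3 : ‖y + (1 / β) • gy x y - ŷ'‖ ≤ p + κ * ‖x - x'‖ := by
    rw [← sub_add_sub_cancel _ ŷ ŷ']
    exact (norm_add_le _ _).trans (by gcongr)
  set s := ‖x - x'‖
  have hp : 0 ≤ p := norm_nonneg _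
  have hs : 0 ≤ s := norm_nonneg _
  have h4 : (p + κ * s) ^ 2 ≤ (1 + 1 / (2 * κ)) * p ^ 2 + (1 + 2 * κ) * (κ * s) ^ 2 := by
    have h8 : 0 ≤ (p - 2 * κ * (κ * s)) ^ 2 / (2 * κ) := by positivity
    have h9 : (p - 2 * κ * (κ * s)) ^ 2 / (2 * κ) =
      1 / (2 * κ) * p ^ 2 + 2 * κ * (κ * s) ^ 2 - 2 * p * (κ * s) := by field_simp; ring
    linarith
  have h5 : (1 + 1 / (2 * κ)) * p ^ 2 ≤ (1 - 1 / (2 * κ)) * ‖y - ŷ‖ ^ 2 := by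
    calc (1 + 1 / (2 * κ)) * p ^ 2 ≤ (1 + 1 / (2 * κ)) * ((1 - 1 / κ) * ‖y - ŷ‖ ^ 2) := by gcongr
      _ = ((1 - 1 / (2 * κ)) - 1 / (2 * κ ^ 2)) * ‖y - ŷ‖ ^ 2 := by field_simp; ring
      _ ≤ _ := mul_le_mul_of_nonneg_right
          (by linarith [show 0 ≤ 1 / (2 * κ ^ 2) by positivity]) (sq_nonneg _)
  have h6 : (1 + 2 * κ) * (κ * s) ^ 2 ≤ 3 * κ ^ 3 * s ^ 2 := by
    have : 0 ≤ (κ - 1) * (κ * s) ^ 2 := mul_nonneg (by linarith) (by positivity)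
    nlinarith
  have h7 : ‖y + (1 / β) • gy x y - ŷ'‖ ^ 2 ≤ (p + κ * s) ^ 2 := by gcongr
  linarith

end IsSaddleFunction

end Saddle

/-! ### Geometric decay of the Lyapunov function and summability of the gradients. -/

section Ascent

/-- The inverse of the rate at which the Lyapunov function of gradient descent ascent decays. -/
def lyapunovRate (β μx μy η : ℝ) : ℝ := 8 / (μx * η) + 4 * (β / μy)

/-- A bound for the sum of the gradients of the empirical risk along gradient descent ascent. -/
def residualBound (β μx μy η DX DY : ℝ) : ℝ :=
  (√(8 / η) + 2 * β / √(2 * (β / μy) * η * β ^ 2)) *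
    (2 * lyapunovRate β μx μy η *
      √(lyapunovRate β μx μy η * (DX / (2 * η) + 2 * η * β ^ 2 * DY)))

theorem residualBound_nonneg {β μx μy η DX DY : ℝ} (hβ : 0 < β) (hμx : 0 < μx) (hμy : 0 < μy)
    (hη : 0 < η) : 0 ≤ residualBound β μx μy η DX DY := by
  unfold residualBound lyapunovRate; positivity

variable {E E' : Type*} [NormedAddCommGroup E] [InnerProductSpace ℝ E]
  [NormedAddCommGroup E'] [InnerProductSpace ℝ E']

theorem norm_sub_sq_le_of_sq_le {x y : E} {D : ℝ} (hx : ‖x‖ ^ 2 ≤ D) (hy : ‖y‖ ^ 2 ≤ D) :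
    ‖x - y‖ ^ 2 ≤ 4 * D := by
  have h := parallelogram_law_with_norm ℝ x y
  nlinarith [sq_nonneg ‖x + y‖]

theorem sum_le_of_contracting {c : ℝ} {u : ℕ → ℝ} {N : ℕ} (h0 : ∀ t ≤ N, 0 ≤ u t)
    (h : ∀ t < N, u (t + 1) ≤ (1 - c) * u t) : c * ∑ t ∈ Finset.range N, u t ≤ u 0 := by
  have h1 : ∑ t ∈ Finset.range N, c * u t ≤ ∑ t ∈ Finset.range N, (u t - u (t + 1)) :=
    Finset.sum_le_sum fun t ht => by linarith [h t (Finset.mem_range.1 ht)]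
  rw [Finset.sum_range_sub', ← Finset.mul_sum] at h1
  linarith [h0 N le_rfl]

namespace IsSaddleFunction

variable {β μx μy : ℝ} {X : Set E} {Y : Set E'} {F : E → E' → ℝ}
  {gx : E → E' → E} {gy : E → E' → E'}

/-- The weight `2κηβ²` is chosen so that the tracking contraction `1/(2κ)` gains `ηβ² ‖y - ŷ‖²`,
twice the error in the descent step. The small step size keeps the drift below the gain in `‖gx‖²`.
-/
theorem lyapunov_step_le (h : IsSaddleFunction β μx μy X Y F gx gy) (hY : Convex ℝ Y)
    (hβ : 0 < β) (hμ : 0 < μy) (hμβ : μy ≤ β) {η : ℝ} (hη : 0 < η)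
    (hηκ : 7 * (β / μy) ^ 2 * (η * β) ≤ 1) {x : E} (hx : x ∈ X) {y ŷ ŷ' : E'} (hy : y ∈ Y)
    (hx' : x - η • gx x y ∈ X) (hy' : y + (1 / β) • gy x y ∈ Y) (hŷ : ŷ ∈ Y)
    (hm : IsMaxOn (F x) Y ŷ) (hŷ' : ŷ' ∈ Y) (hm' : IsMaxOn (F (x - η • gx x y)) Y ŷ') :
    F (x - η • gx x y) ŷ' + 2 * (β / μy) * η * β ^ 2 * ‖y + (1 / β) • gy x y - ŷ'‖ ^ 2 ≤
      F x ŷ + 2 * (β / μy) * η * β ^ 2 * ‖y - ŷ‖ ^ 2 -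
        (η / 8 * ‖gx x y‖ ^ 2 + η * β ^ 2 / 2 * ‖y - ŷ‖ ^ 2) := by
  have h1 := h.descent_step_le hY hμ hη hx hy hx' hŷ hm hŷ'
  have h2 := h.tracking_step_le hY hβ hμ hμβ hx hx' hy hy' hŷ hm hŷ' hm'
  rw [sub_sub_cancel, norm_smul, Real.norm_of_nonneg hη.le] at h2
  have e0 : β ^ 2 / μy = β / μy * β := by ring
  rw [e0] at h1
  set κ := β / μy with hκ
  have hκ1 : 1 ≤ κ := by rw [hκ, one_le_div hμ]; exact hμβ
  have hκ0 : 0 < κ := by positivity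
  set s := ‖gx x y‖
  set q := ‖y - ŷ‖
  have h3 := mul_le_mul_of_nonneg_left h2 (show 0 ≤ 2 * κ * η * β ^ 2 by positivity)
  set a := κ ^ 2 * (η * β) with ha
  have ha0 : 0 < a := by positivity
  have ha1 : a ≤ 1 / 7 := by linarith
  have hκ2 : κ ≤ κ ^ 2 := by nlinarith
  have hηβ : 0 < η * β := by positivity
  have hκa : κ * (η * β) ≤ a := mul_le_mul_of_nonneg_right hκ2 hηβ.le
  have hβa : η * β ≤ a := by nlinarith
  have e1 : 2 * κ * η * β ^ 2 * ((1 - 1 / (2 * κ)) * q ^ 2 + 3 * κ ^ 3 * (η * s) ^ 2) =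
      2 * κ * η * β ^ 2 * q ^ 2 - η * β ^ 2 * q ^ 2 + 6 * a ^ 2 * (η * s ^ 2) := by
    rw [ha]; field_simp; ring
  have e2 : (1 / (2 * η) - (β + κ * β) / 2) * (η * s) ^ 2 =
      (1 / 2 - (η * β + κ * (η * β)) / 2) * (η * s ^ 2) := by field_simp
  have hs : 0 ≤ η * s ^ 2 := by positivity
  have h4 : (1 / 2 - (η * β + κ * (η * β)) / 2) * (η * s ^ 2) ≥ (5 / 14) * (η * s ^ 2) :=
    mul_le_mul_of_nonneg_right (by linarith) hs
  have h5 : 6 * a ^ 2 * (η * s ^ 2) ≤ (6 / 49) * (η * s ^ 2) :=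
    mul_le_mul_of_nonneg_right (by nlinarith) hs
  rw [e1] at h3
  rw [e2] at h1
  linarith

/-- The Polyak-Łojasiewicz bound, with the gradient moved from `ŷ` to `y`, shows that one step
removes a fixed fraction of the Lyapunov function. -/
theorem lyapunov_le (h : IsSaddleFunction β μx μy X Y F gx gy) (hβ : 0 < β) (hμx : 0 < μx)
    (hμ : 0 < μy) {η : ℝ} (hη : 0 < η) {x : E} (hx : x ∈ X) {y ŷ : E'} (hy : y ∈ Y)
    (hŷ : ŷ ∈ Y) {m : ℝ} (hm : F x ŷ - m ≤ ‖gx x ŷ‖ ^ 2 / (2 * μx)) :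
    F x ŷ - m + 2 * (β / μy) * η * β ^ 2 * ‖y - ŷ‖ ^ 2 ≤ lyapunovRate β μx μy η *
      (η / 8 * ‖gx x y‖ ^ 2 + η * β ^ 2 / 2 * ‖y - ŷ‖ ^ 2) := by
  have h2 := h.lip_x x hx x hx ŷ hŷ y hy
  rw [sub_self, norm_zero, zero_add, norm_sub_rev ŷ y] at h2
  have h3 : ‖gx x ŷ‖ ≤ ‖gx x y‖ + β * ‖y - ŷ‖ := by
    have := norm_le_norm_add_norm_sub' (gx x ŷ) (gx x y)
    linarith
  have h4 : ‖gx x ŷ‖ ^ 2 ≤ 2 * ‖gx x y‖ ^ 2 + 2 * (β * ‖y - ŷ‖) ^ 2 := by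
    have h5 : ‖gx x ŷ‖ ^ 2 ≤ (‖gx x y‖ + β * ‖y - ŷ‖) ^ 2 := by gcongr
    nlinarith [sq_nonneg (‖gx x y‖ - β * ‖y - ŷ‖)]
  have h5 : ‖gx x ŷ‖ ^ 2 / (2 * μx) ≤ (‖gx x y‖ ^ 2 + β ^ 2 * ‖y - ŷ‖ ^ 2) / μx := by
    rw [div_le_div_iff₀ (by positivity) hμx]
    nlinarith
  have e : lyapunovRate β μx μy η * (η / 8 * ‖gx x y‖ ^ 2 + η * β ^ 2 / 2 * ‖y - ŷ‖ ^ 2) =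
      (‖gx x y‖ ^ 2 + β ^ 2 * ‖y - ŷ‖ ^ 2) / μx + 2 * (β / μy) * η * β ^ 2 * ‖y - ŷ‖ ^ 2 +
      (3 * β ^ 2 * ‖y - ŷ‖ ^ 2 / μx + β / μy * η / 2 * ‖gx x y‖ ^ 2) := by
    unfold lyapunovRate; field_simp; ring
  rw [e]
  have : 0 ≤ 3 * β ^ 2 * ‖y - ŷ‖ ^ 2 / μx + β / μy * η / 2 * ‖gx x y‖ ^ 2 := by positivity
  linarith

theorem residual_le (h : IsSaddleFunction β μx μy X Y F gx gy) (hY : Convex ℝ Y)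
    (hYc : IsCompact Y) {DX DY : ℝ} (hDX : ∀ x ∈ X, ‖x‖ ^ 2 ≤ DX) (hDY : ∀ y ∈ Y, ‖y‖ ^ 2 ≤ DY)
    (hβ : 0 < β) (hμx : 0 < μx) (hμ : 0 < μy) (hμβ : μy ≤ β) {η : ℝ} (hη : 0 < η)
    (hηκ : 7 * (β / μy) ^ 2 * (η * β) ≤ 1) {x : ℕ → E} {y : ℕ → E'}
    (hxs : ∀ t, x (t + 1) = x t - η • gx (x t) (y t))
    (hys : ∀ t, y (t + 1) = y t + (1 / β) • gy (x t) (y t)) {N : ℕ}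
    (hX : ∀ t ≤ N + 1, x t ∈ X) (hYm : ∀ t ≤ N + 1, y t ∈ Y) :
    ∑ t ∈ Finset.range (N + 1), (‖gx (x t) (y t)‖ + ‖gy (x t) (y t)‖) ≤
        residualBound β μx μy η DX DY ∧
      (N + 1) * (‖gx (x N) (y N)‖ + ‖gy (x N) (y N)‖) ≤ residualBound β μx μy η DX DY := by
  have hx0 := hX 0 (by omega)
  have hy0 := hYm 0 (by omega)
  have hex : ∀ w ∈ X, ∃ v ∈ Y, IsMaxOn (F w) Y v := fun w hw =>
    hYc.exists_isMaxOn ⟨_, hy0⟩ (h.continuousOn_right hw)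
  choose! yh hyh hmax using hex
  -- The infimum serves as reference value, so no minimizer over `X` has to exist.
  set m := sInf ((fun w => F w (yh w)) '' X) with hmdef
  have hgap : ∀ w ∈ X, ∀ w' ∈ X, F w (yh w) - F w' (yh w') ≤ ‖gx w (yh w)‖ ^ 2 / (2 * μx) :=
    fun w hw w' hw' => h.sub_le_of_isMaxOn hμx hw hw' (hyh w hw) (hmax w' hw')
  have hbdd : BddBelow ((fun w => F w (yh w)) '' X) := by
    refine ⟨F (x 0) (yh (x 0)) - ‖gx (x 0) (yh (x 0))‖ ^ 2 / (2 * μx), ?_⟩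
    rintro _ ⟨w, hw, rfl⟩
    linarith [hgap _ hx0 w hw]
  have hm_le : ∀ w ∈ X, m ≤ F w (yh w) := fun w hw => csInf_le hbdd ⟨w, hw, rfl⟩
  have hm_gap : ∀ w ∈ X, F w (yh w) - m ≤ ‖gx w (yh w)‖ ^ 2 / (2 * μx) := fun w hw => by
    have : F w (yh w) - ‖gx w (yh w)‖ ^ 2 / (2 * μx) ≤ m := by
      refine le_csInf ⟨_, ⟨_, hx0, rfl⟩⟩ ?_
      rintro _ ⟨w', hw', rfl⟩
      linarith [hgap w hw w' hw']
    linarith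
  set K := lyapunovRate β μx μy η with hK
  have hκ1 : 1 ≤ β / μy := by rw [one_le_div hμ]; exact hμβ
  have hK4 : 4 ≤ K := by
    have : 0 < 8 / (μx * η) := by positivity
    rw [hK, lyapunovRate]; linarith
  set ρ := 2 * (β / μy) * η * β ^ 2 with hρ
  have hρ0 : 0 < ρ := by positivity
  set V : ℕ → ℝ := fun t => F (x t) (yh (x t)) - m + ρ * ‖y t - yh (x t)‖ ^ 2 with hV
  have hV0 : ∀ t ≤ N + 1, 0 ≤ V t := fun t ht => by
    have := hm_le _ (hX t ht)
    have : 0 ≤ ρ * ‖y t - yh (x t)‖ ^ 2 := by positivity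
    simp only [hV]; linarith
  have hVK : ∀ t ≤ N + 1, V t ≤ K * (η / 8 * ‖gx (x t) (y t)‖ ^ 2 +
      η * β ^ 2 / 2 * ‖y t - yh (x t)‖ ^ 2) := fun t ht =>
    h.lyapunov_le hβ hμx hμ hη (hX t ht) (hYm t ht) (hyh _ (hX t ht)) (hm_gap _ (hX t ht))
  have hVstep : ∀ t < N + 1, V (t + 1) ≤ V t - (η / 8 * ‖gx (x t) (y t)‖ ^ 2 +
      η * β ^ 2 / 2 * ‖y t - yh (x t)‖ ^ 2) := fun t ht => by
    have a1 := hX (t + 1) (by omega)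
    have a2 := hYm (t + 1) (by omega)
    have a3 := hyh _ a1
    have a4 := hmax _ a1
    have := h.lyapunov_step_le hY hβ hμ hμβ hη hηκ (hX t (by omega)) (hYm t (by omega))
      (by rw [← hxs]; exact a1) (by rw [← hys]; exact a2) (hyh _ (hX t (by omega)))
      (hmax _ (hX t (by omega))) a3 (by rw [← hxs]; exact a4)
    rw [← hxs, ← hys] at this
    simp only [hV]
    linarith
  -- A contraction of `V` by `1 - 1/K` contracts `√V` by `1 - 1/(2K)`. Gradients are controlled by
  -- `√V`, so this is the quantity to be summed.
  have hsqrt : ∀ t < N + 1, √(V (t + 1)) ≤ (1 - 1 / (2 * K)) * √(V t) := fun t ht => by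
    have h1 := hVstep t ht
    have h2 := hVK t (by omega)
    have h3 : V t / K ≤ η / 8 * ‖gx (x t) (y t)‖ ^ 2 +
      η * β ^ 2 / 2 * ‖y t - yh (x t)‖ ^ 2 := by
      rw [div_le_iff₀ (by linarith)]; linarith
    have h4 : 0 ≤ 1 - 1 / (2 * K) := by
      rw [sub_nonneg, div_le_one (by linarith)]; linarith
    apply Real.sqrt_le_iff.2
    refine ⟨by positivity, ?_⟩
    rw [mul_pow, Real.sq_sqrt (hV0 t (by omega))]
    have h5 : (1 - 1 / (2 * K)) ^ 2 * V t = V t - V t / K + (1 / (2 * K)) ^ 2 * V t := by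
      field_simp; ring
    have : 0 ≤ (1 / (2 * K)) ^ 2 * V t := mul_nonneg (sq_nonneg _) (hV0 t (by omega))
    linarith
  set C := √(8 / η) + 2 * β / √ρ with hC
  have hC0 : 0 ≤ C := by positivity
  have hres : ∀ t < N + 1, ‖gx (x t) (y t)‖ + ‖gy (x t) (y t)‖ ≤ C * √(V t) := fun t ht => by
    have h1 := hVstep t ht
    have h0 := hV0 (t + 1) (by omega)
    have hp : 0 ≤ η * β ^ 2 / 2 * ‖y t - yh (x t)‖ ^ 2 := by positivity
    have hp' : 0 ≤ η / 8 * ‖gx (x t) (y t)‖ ^ 2 := by positivity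
    have hgx : ‖gx (x t) (y t)‖ ≤ √(8 / η) * √(V t) := by
      rw [← Real.sqrt_mul (by positivity)]
      apply Real.le_sqrt_of_sq_le
      rw [div_mul_eq_mul_div, le_div_iff₀ hη]
      linarith
    have hd : ‖y t - yh (x t)‖ ≤ √(V t) / √ρ := by
      rw [← Real.sqrt_div' _ hρ0.le]
      apply Real.le_sqrt_of_sq_le
      rw [le_div_iff₀ hρ0]
      have := hm_le _ (hX t (by omega))
      simp only [hV]; linarith
    -- On the boundary of `Y` the gradient need not be small near a maximizer. It is small here
    -- because the step `gy / β` leads from `y t` to a point of `Y` no farther from the maximizer.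
    have hgy : ‖gy (x t) (y t)‖ ≤ 2 * β * ‖y t - yh (x t)‖ := by
      have a1 := h.norm_ascent_sub_sq_le hβ (hX t (by omega)) (hYm t (by omega))
        (by rw [← hys]; exact hYm (t + 1) (by omega)) (hyh _ (hX t (by omega)))
        (hmax _ (hX t (by omega)))
      have a2 : ‖y t + (1 / β) • gy (x t) (y t) - yh (x t)‖ ≤ ‖y t - yh (x t)‖ := by
        refine le_of_sq_le_sq (a1.trans ?_) (norm_nonneg _)
        have : 0 ≤ μy / β * ‖y t - yh (x t)‖ ^ 2 := by positivity
        linarith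
      have a3 : ‖(1 / β) • gy (x t) (y t)‖ ≤ 2 * ‖y t - yh (x t)‖ := by
        have e : (1 / β) • gy (x t) (y t) =
          (y t + (1 / β) • gy (x t) (y t) - yh (x t)) - (y t - yh (x t)) := by abel
        rw [e]
        exact (norm_sub_le _ _).trans (by linarith)
      rw [norm_smul, Real.norm_of_nonneg (by positivity), one_div, inv_mul_le_iff₀ hβ] at a3
      linarith
    calc _ ≤ √(8 / η) * √(V t) + 2 * β * (√(V t) / √ρ) := by
          refine add_le_add hgx (hgy.trans ?_)
          gcongr
      _ = _ := by rw [hC]; ring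
  have hsum : ∑ t ∈ Finset.range (N + 1), √(V t) ≤ 2 * K * √(V 0) := by
    have := sum_le_of_contracting (fun t _ => Real.sqrt_nonneg (V t)) hsqrt
    rw [div_mul_eq_mul_div, one_mul, div_le_iff₀ (by linarith)] at this
    linarith
  -- No bound on `F` is needed: `η • gx` is the difference of the first two iterates, both of which
  -- lie in `X`.
  have hVz : V 0 ≤ K * (DX / (2 * η) + 2 * η * β ^ 2 * DY) := by
    refine (hVK 0 (by omega)).trans ?_
    have a1 := norm_sub_sq_le_of_sq_le (hDX _ hx0) (hDX _ (hX 1 (by omega)))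
    rw [hxs 0, sub_sub_cancel, norm_smul, mul_pow, Real.norm_of_nonneg hη.le] at a1
    have a2 := norm_sub_sq_le_of_sq_le (hDY _ hy0) (hDY _ (hyh _ hx0))
    have a3 : η / 8 * ‖gx (x 0) (y 0)‖ ^ 2 ≤ DX / (2 * η) := by
      rw [le_div_iff₀ (by positivity)]
      nlinarith
    have a4 := mul_le_mul_of_nonneg_left a2 (show 0 ≤ η * β ^ 2 / 2 by positivity)
    exact mul_le_mul_of_nonneg_left (by linarith) (by linarith)
  have hfin : C * ∑ t ∈ Finset.range (N + 1), √(V t) ≤ residualBound β μx μy η DX DY := by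
    rw [residualBound]
    gcongr
    exact hsum.trans (by gcongr)
  refine ⟨le_trans ?_ hfin, le_trans ?_ hfin⟩
  · rw [Finset.mul_sum]
    exact Finset.sum_le_sum fun t ht => hres t (Finset.mem_range.1 ht)
  -- The numbers `√(V t)` decrease, so the last of them is at most their average.
  · have hmon : ∀ j ≤ N, √(V N) ≤ √(V (N - j)) := by
      intro j
      induction j with
      | zero => simp
      | succ j ih =>
        intro hj
        refine (ih (by omega)).trans ?_
        have := hsqrt (N - (j + 1)) (by omega)
        rw [show N - (j + 1) + 1 = N - j by omega] at this
        refine this.trans ?_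
        have : 0 ≤ 1 / (2 * K) * √(V (N - (j + 1))) := by positivity
        linarith
    have hcard : (N + 1) * √(V N) ≤ ∑ t ∈ Finset.range (N + 1), √(V t) := by
      have := Finset.card_nsmul_le_sum (Finset.range (N + 1)) (fun t => √(V t)) (√(V N))
        fun t ht => by
          have h1 := Finset.mem_range.1 ht
          have := hmon (N - t) (by omega)
          rwa [show N - (N - t) = t by omega] at this
      simpa using this
    calc _ ≤ (N + 1) * (C * √(V N)) := by gcongr; exact hres N (by omega)
      _ = C * ((N + 1) * √(V N)) := by ring
      _ ≤ _ := by gcongr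

end IsSaddleFunction

end Ascent

/-! ### Distance of the iterates to a point that is optimal for another, nearby problem. -/

section Comparison

/-- The constant in the bounds for the averaged iterate of gradient descent ascent. -/
def averageBound (β μ M DX : ℝ) : ℝ := (1 + 2 * (β + 1) / μ) * (1 + 2 * M) + 2 * √DX

variable {E E' : Type*} [NormedAddCommGroup E] [InnerProductSpace ℝ E]
  [NormedAddCommGroup E'] [InnerProductSpace ℝ E']

namespace IsSaddleFunction

variable {β μ : ℝ} {X : Set E} {Y : Set E'} {F : E → E' → ℝ}
  {gx : E → E' → E} {gy : E → E' → E'}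

/-- `G` and `H` stand for the population gradients at `(xs, ys)`, whose contributions to the
monotonicity inequality have a favorable sign. The deviations are bounded only in directions
pointing into the domain, so `e = 0` is possible even when the gradients themselves deviate. -/
theorem norm_add_norm_le {μx μy : ℝ} (h : IsSaddleFunction β μx μy X Y F gx gy) (hμx : μ ≤ μx)
    (hμy : μ ≤ μy) (hμ : 0 < μ) {x xs G : E} {y ys H : E'} {e : ℝ} (he : 0 ≤ e)
    (hx : x ∈ X) (hxs : xs ∈ X) (hy : y ∈ Y) (hys : ys ∈ Y)
    (hG : 0 ≤ inner ℝ G (x - xs)) (hH : inner ℝ H (y - ys) ≤ 0)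
    (hX : |inner ℝ (gx xs ys - G) (x - xs)| ≤ e * ‖x - xs‖)
    (hY : |inner ℝ (gy xs ys - H) (y - ys)| ≤ e * ‖y - ys‖) :
    ‖x - xs‖ + ‖y - ys‖ ≤ 2 / μ * (‖gx x y‖ + ‖gy x y‖ + e) := by
  have h1 := h.monotone hx hxs hy hys
  have h2 := real_inner_le_norm (gx x y) (x - xs)
  have h3 := neg_le_of_abs_le (abs_real_inner_le_norm (gy x y) (y - ys))
  have h4 := neg_le_of_abs_le hX
  have h5 := le_of_abs_le hY
  rw [inner_sub_left] at h4 h5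
  rw [inner_sub_left, inner_sub_left] at h1
  set a := ‖x - xs‖
  set b := ‖y - ys‖
  have ha : 0 ≤ a := norm_nonneg _
  have hb : 0 ≤ b := norm_nonneg _
  have h6 : μ * a ^ 2 ≤ μx * a ^ 2 := by gcongr
  have h7 : μ * b ^ 2 ≤ μy * b ^ 2 := by gcongr
  set p := ‖gx x y‖
  set q := ‖gy x y‖
  have hp : 0 ≤ p := norm_nonneg _
  have hq : 0 ≤ q := norm_nonneg _
  have h8 : μ * (a ^ 2 + b ^ 2) ≤ (p + q + e) * (a + b) := by nlinarith
  rw [div_mul_eq_mul_div, le_div_iff₀ hμ]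
  rcases (add_nonneg ha hb).eq_or_lt with h0 | h0
  · rw [← h0, zero_mul]; positivity
  · refine le_of_mul_le_mul_right ?_ h0
    nlinarith [sq_nonneg (a - b)]

theorem norm_average_sub_le {μx μy : ℝ} (h : IsSaddleFunction β μx μy X Y F gx gy)
    (hμx : μ ≤ μx) (hμy : μ ≤ μy) (hμ : 0 < μ) (hβ : 0 < β) {DX M e : ℝ}
    (hDX : ∀ x ∈ X, ‖x‖ ^ 2 ≤ DX) (hM : 0 ≤ M) (he : 0 ≤ e) {xs G : E} {ys H : E'}
    (hxs : xs ∈ X) (hys : ys ∈ Y)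
    (hG : ∀ x ∈ X, 0 ≤ inner ℝ G (x - xs)) (hH : ∀ y ∈ Y, inner ℝ H (y - ys) ≤ 0)
    (hX : ∀ x ∈ X, |inner ℝ (gx xs ys - G) (x - xs)| ≤ e * ‖x - xs‖)
    (hY : ∀ y ∈ Y, |inner ℝ (gy xs ys - H) (y - ys)| ≤ e * ‖y - ys‖)
    {x : ℕ → E} {y : ℕ → E'} {N : ℕ} (hx : ∀ t ≤ N + 1, x t ∈ X) (hy : ∀ t ≤ N + 1, y t ∈ Y)
    (hsum : ∑ t ∈ Finset.range (N + 1), (‖gx (x t) (y t)‖ + ‖gy (x t) (y t)‖) ≤ M) :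
    ‖(1 / ((N + 2 : ℕ) : ℝ)) • ∑ t ∈ Finset.range (N + 2), x t - xs‖ ≤
      averageBound β μ M DX * (e + 1 / ((N + 2 : ℕ) : ℝ)) := by
  set T : ℝ := ((N + 2 : ℕ) : ℝ) with hT
  have hT0 : 0 < T := by rw [hT]; positivity
  have hTN : (N : ℝ) + 1 ≤ T := by rw [hT]; push_cast; linarith
  have e1 : (1 / T) • ∑ t ∈ Finset.range (N + 2), x t - xs =
      (1 / T) • ∑ t ∈ Finset.range (N + 2), (x t - xs) := by
    rw [Finset.sum_sub_distrib, smul_sub, Finset.sum_const, Finset.card_range,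
      ← Nat.cast_smul_eq_nsmul ℝ, smul_smul, one_div, inv_mul_cancel₀ hT0.ne', one_smul]
  rw [e1, norm_smul, Real.norm_of_nonneg (by positivity), one_div, inv_mul_le_iff₀ hT0]
  -- The last averaged iterate has no successor known to lie in the domain, so its gradient is not
  -- controlled. The diameter bound costs only `O(1/T)` after averaging.
  have hlast : ‖x (N + 1) - xs‖ ≤ 2 * √DX := by
    have hb : ∀ x ∈ X, ‖x‖ ≤ √DX := fun x hx => Real.le_sqrt_of_sq_le (hDX x hx)
    have := norm_sub_le (x (N + 1)) xs
    linarith [hb _ (hx (N + 1) le_rfl), hb _ hxs]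
  have hstep : ∀ t ∈ Finset.range (N + 1),
      ‖x t - xs‖ ≤ 2 / μ * (‖gx (x t) (y t)‖ + ‖gy (x t) (y t)‖ + e) := fun t ht => by
    have h1 : t ≤ N + 1 := (Finset.mem_range.1 ht).le
    have := h.norm_add_norm_le hμx hμy hμ he (hx t h1) hxs (hy t h1) hys (hG _ (hx t h1))
      (hH _ (hy t h1)) (hX _ (hx t h1)) (hY _ (hy t h1))
    linarith [norm_nonneg (y t - ys)]
  have hs : ∑ t ∈ Finset.range (N + 1), ‖x t - xs‖ ≤ 2 / μ * (M + T * e) := by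
    refine (Finset.sum_le_sum hstep).trans ?_
    rw [← Finset.mul_sum, Finset.sum_add_distrib, Finset.sum_const, Finset.card_range,
      nsmul_eq_mul]
    push_cast
    gcongr
  calc ‖∑ t ∈ Finset.range (N + 2), (x t - xs)‖
      ≤ ∑ t ∈ Finset.range (N + 2), ‖x t - xs‖ := norm_sum_le _ _
    _ ≤ 2 / μ * (M + T * e) + 2 * √DX := by
        rw [Finset.sum_range_succ]; exact add_le_add hs hlast
    _ ≤ T * (averageBound β μ M DX * e) + averageBound β μ M DX := by
        have h1 : 2 / μ ≤ averageBound β μ M DX := by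
          have : averageBound β μ M DX = 2 / μ + (1 + 2 * β / μ + 2 * M * (1 + 2 * (β + 1) / μ)
            + 2 * √DX) := by rw [averageBound]; ring
          have : 0 ≤ 1 + 2 * β / μ + 2 * M * (1 + 2 * (β + 1) / μ) + 2 * √DX := by positivity
          linarith
        have h2 : 2 / μ * M + 2 * √DX ≤ averageBound β μ M DX := by
          have : averageBound β μ M DX = (2 / μ * M + 2 * √DX) + ((1 + 2 * (β + 1) / μ) +
            2 * M * (1 + 2 * β / μ) + 2 / μ * M) := by rw [averageBound]; ring
          have : 0 ≤ (1 + 2 * (β + 1) / μ) + 2 * M * (1 + 2 * β / μ) + 2 / μ * M := by positivity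
          linarith
        have h3 := mul_le_mul_of_nonneg_right h1 (show 0 ≤ T * e by positivity)
        linarith
    _ = T * (averageBound β μ M DX * (e + T⁻¹)) := by field_simp

/-- `G` differs by at most `e` from the gradient at `(xs, ys)`, which by Lipschitz continuity is
close to the gradient at `(x, y)`, itself at most `M / (N + 1)`. So `G` is small although `xs` may
be a boundary point. -/
theorem norm_gradient_le {μx μy : ℝ} (h : IsSaddleFunction β μx μy X Y F gx gy)
    (hμx : μ ≤ μx) (hμy : μ ≤ μy) (hμ : 0 < μ) (hβ : 0 < β) {DX M e : ℝ}
    (hM : 0 ≤ M) (he : 0 ≤ e) {x xs G : E} {y ys H : E'}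
    (hx : x ∈ X) (hxs : xs ∈ X) (hy : y ∈ Y) (hys : ys ∈ Y)
    (hG : 0 ≤ inner ℝ G (x - xs)) (hH : inner ℝ H (y - ys) ≤ 0)
    (hX : ‖gx xs ys - G‖ ≤ e) (hY : ‖gy xs ys - H‖ ≤ e) {N : ℕ}
    (hN : (N + 1) * (‖gx x y‖ + ‖gy x y‖) ≤ M) :
    ‖G‖ ≤ averageBound β μ M DX * (e + 1 / ((N + 2 : ℕ) : ℝ)) := by
  have h1 := h.norm_add_norm_le hμx hμy hμ he hx hxs hy hys hG hH
    ((abs_real_inner_le_norm _ _).trans (by gcongr))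
    ((abs_real_inner_le_norm _ _).trans (by gcongr))
  have h2 := h.lip_x xs hxs x hx ys hys y hy
  rw [norm_sub_rev xs, norm_sub_rev ys] at h2
  have h3 : ‖G‖ ≤ ‖gx xs ys - G‖ + ‖gx xs ys - gx x y‖ + ‖gx x y‖ := by
    have e1 : G = -(gx xs ys - G) + (gx xs ys - gx x y) + gx x y := by abel
    calc ‖G‖ = ‖-(gx xs ys - G) + (gx xs ys - gx x y) + gx x y‖ := by rw [← e1]
      _ ≤ _ := by
        refine (norm_add_le _ _).trans ?_
        gcongr
        refine (norm_add_le _ _).trans ?_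
        rw [norm_neg]
  have hT : (0 : ℝ) < ((N + 2 : ℕ) : ℝ) := by positivity
  set R := ‖gx x y‖ + ‖gy x y‖ with hR
  have hR0 : 0 ≤ R := by positivity
  have hRM : R ≤ 2 * M * (1 / ((N + 2 : ℕ) : ℝ)) := by
    rw [mul_one_div, le_div_iff₀ hT]
    push_cast
    have : (0 : ℝ) ≤ N * R := by positivity
    nlinarith
  have h4 := mul_le_mul_of_nonneg_left h1 hβ.le
  have h5 : ‖gx x y‖ ≤ R := by linarith [norm_nonneg (gy x y)]
  set w := 1 / ((N + 2 : ℕ) : ℝ)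
  have hw : 0 ≤ w := by positivity
  calc ‖G‖ ≤ (1 + 2 * β / μ) * (e + R) := by
        have : β * (2 / μ * (R + e)) = 2 * β / μ * (e + R) := by ring
        linarith
    _ ≤ (1 + 2 * (β + 1) / μ) * (e + 2 * M * w) := by gcongr; linarith
    _ ≤ (1 + 2 * (β + 1) / μ) * ((1 + 2 * M) * (e + w)) := by
        gcongr
        nlinarith [mul_nonneg hM he]
    _ ≤ _ := by
        rw [averageBound, ← mul_assoc]
        gcongr
        linarith [Real.sqrt_nonneg DX]

end IsSaddleFunction

end Comparison

/-! ### The descent lemma on a convex set. -/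

section Smoothness

variable {E : Type*} [NormedAddCommGroup E] [InnerProductSpace ℝ E] [CompleteSpace E]

theorem hasGradientAt_neg {g : E → ℝ} {v x : E} (h : HasGradientAt g v x) :
    HasGradientAt (fun w => -g w) (-v) x := by
  rw [hasGradientAt_iff_hasFDerivAt] at h ⊢
  rw [map_neg]
  exact h.neg

theorem hasGradientAt_average {ι : Type*} [Fintype ι] {g : ι → E → ℝ} {v : ι → E} {x : E}
    (c : ℝ) (h : ∀ i, HasGradientAt (g i) (v i) x) :
    HasGradientAt (fun w => c * ∑ i, g i w) (c • ∑ i, v i) x := by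
  simp_rw [hasGradientAt_iff_hasFDerivAt] at h ⊢
  have := (HasFDerivAt.fun_sum fun i (_ : i ∈ Finset.univ) => h i).const_mul c
  simpa [map_smul, map_sum] using this

/-- Along the segment, `g` minus its linear and quadratic upper model has non-positive derivative.
-/
theorem sub_le_of_gradient_lipschitz {g : E → ℝ} {g' : E → E} {s : Set E} (hs : Convex ℝ s)
    {β : ℝ} (hg : ∀ w ∈ s, HasGradientAt g (g' w) w)
    (hL : ∀ w ∈ s, ∀ w' ∈ s, ‖g' w - g' w'‖ ≤ β * ‖w - w'‖) {w w' : E} (hw : w ∈ s)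
    (hw' : w' ∈ s) : g w' - g w ≤ inner ℝ (g' w) (w' - w) + β / 2 * ‖w' - w‖ ^ 2 := by
  set v := w' - w with hv
  have hmem : ∀ t ∈ Set.Icc (0 : ℝ) 1, w + t • v ∈ s := fun t ht => hs.add_smul_sub_mem hw hw' ht
  set φ : ℝ → ℝ := fun t => g (w + t • v) - t * inner ℝ (g' w) v - β / 2 * ‖v‖ ^ 2 * t ^ 2 with hφ
  have hd : ∀ t ∈ Set.Icc (0 : ℝ) 1,
      HasDerivAt φ (inner ℝ (g' (w + t • v)) v - inner ℝ (g' w) v - β * ‖v‖ ^ 2 * t) t := by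
    intro t ht
    have h1 : HasDerivAt (fun t : ℝ => w + t • v) v t := by
      simpa using ((hasDerivAt_id t).smul_const v).const_add w
    have h2 := (hg _ (hmem t ht)).hasFDerivAt.comp_hasDerivAt t h1
    have h3 := (h2.sub ((hasDerivAt_id t).mul_const (inner ℝ (g' w) v))).sub
      ((hasDerivAt_pow 2 t).const_mul (β / 2 * ‖v‖ ^ 2))
    refine HasDerivAt.congr_deriv (f := φ) h3 ?_
    rw [InnerProductSpace.toDual_apply_apply]
    push_cast
    ring
  have hanti : AntitoneOn φ (Set.Icc 0 1) := by
    refine antitoneOn_of_deriv_nonpos (convex_Icc 0 1)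
      (fun t ht => (hd t ht).continuousAt.continuousWithinAt)
      (fun t ht => (hd t (interior_subset ht)).differentiableAt.differentiableWithinAt)
      fun t ht => ?_
    have ht' := interior_subset ht
    rw [(hd t ht').deriv, ← inner_sub_left]
    have h1 := real_inner_le_norm (g' (w + t • v) - g' w) v
    have h2 := hL _ (hmem t ht') _ hw
    rw [add_sub_cancel_left, norm_smul, Real.norm_of_nonneg ht'.1] at h2
    nlinarith [mul_le_mul_of_nonneg_right h2 (norm_nonneg v)]
  have := hanti (Set.left_mem_Icc.2 zero_le_one) (Set.right_mem_Icc.2 zero_le_one) zero_le_one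
  simp only [hφ, zero_smul, add_zero, one_smul] at this
  rw [show w + v = w' by rw [hv]; abel] at this
  linarith

theorem abs_sub_sub_le_of_gradient_lipschitz {g : E → ℝ} {g' : E → E} {s : Set E}
    (hs : Convex ℝ s) {β : ℝ} (hg : ∀ w ∈ s, HasGradientAt g (g' w) w)
    (hL : ∀ w ∈ s, ∀ w' ∈ s, ‖g' w - g' w'‖ ≤ β * ‖w - w'‖) {w w' : E} (hw : w ∈ s)
    (hw' : w' ∈ s) : |g w' - g w - inner ℝ (g' w) (w' - w)| ≤ β / 2 * ‖w' - w‖ ^ 2 := by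
  have h1 := sub_le_of_gradient_lipschitz hs hg hL hw hw'
  have h2 := sub_le_of_gradient_lipschitz (g' := fun w => -g' w) hs
    (fun w hw => hasGradientAt_neg (hg w hw))
    (fun w hw w' hw' => by
      rw [neg_sub_neg, norm_sub_rev]; exact hL w hw w' hw') hw hw'
  rw [inner_neg_left] at h2
  rw [abs_le]
  constructor <;> linarith

end Smoothness

/-! ### From the losses `f(·, ·; z)` to saddle functions, single and averaged. -/

section Bridge

variable {d d' : ℕ} {Z : Type*} {β : ℝ} {X : Set (Vec d)} {Y : Set (Vec d')}
  {f : Vec d → Vec d' → Z → ℝ}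

namespace IsSmoothOn

theorem hasGradientAt_x (h : IsSmoothOn β X Y f) {x : Vec d} {y : Vec d'} (hx : x ∈ X)
    (hy : y ∈ Y) (z : Z) : HasGradientAt (fun x' => f x' y z) (gradX f x y z) x := by
  have h1 := h.1 x hx y hy z
  have h2 : DifferentiableAt ℝ (fun x' : Vec d => (x', y)) x := by fun_prop
  exact (DifferentiableAt.comp x (f := fun x' : Vec d => (x', y)) h1 h2).hasGradientAt

theorem hasGradientAt_y (h : IsSmoothOn β X Y f) {x : Vec d} {y : Vec d'} (hx : x ∈ X)
    (hy : y ∈ Y) (z : Z) : HasGradientAt (fun y' => f x y' z) (gradY f x y z) y := by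
  have h1 := h.1 x hx y hy z
  have h2 : DifferentiableAt ℝ (fun y' : Vec d' => (x, y')) y := by fun_prop
  exact (DifferentiableAt.comp y (f := fun y' : Vec d' => (x, y')) h1 h2).hasGradientAt

theorem lipschitz (h : IsSmoothOn β X Y f) (hβ : 0 ≤ β) {x x' : Vec d} {y y' : Vec d'}
    (hx : x ∈ X) (hx' : x' ∈ X) (hy : y ∈ Y) (hy' : y' ∈ Y) (z : Z) :
    ‖gradX f x y z - gradX f x' y' z‖ ≤ β * (‖x - x'‖ + ‖y - y'‖) ∧
      ‖gradY f x y z - gradY f x' y' z‖ ≤ β * (‖x - x'‖ + ‖y - y'‖) := by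
  have h1 := h.2 x hx x' hx' y hy y' hy' z
  have h2 : √(‖x - x'‖ ^ 2 + ‖y - y'‖ ^ 2) ≤ ‖x - x'‖ + ‖y - y'‖ := by
    apply Real.sqrt_le_iff.2
    refine ⟨by positivity, ?_⟩
    have : 0 ≤ ‖x - x'‖ * ‖y - y'‖ := by positivity
    nlinarith
  have h3 := h1.trans (mul_le_mul_of_nonneg_left h2 hβ)
  exact ⟨(Real.le_sqrt_of_sq_le (by linarith [sq_nonneg ‖gradY f x y z - gradY f x' y' z‖])).trans
    h3, (Real.le_sqrt_of_sq_le (by linarith [sq_nonneg ‖gradX f x y z - gradX f x' y' z‖])).trans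
    h3⟩

theorem abs_sub_sub_le_x (h : IsSmoothOn β X Y f) (hX : Convex ℝ X) (hβ : 0 ≤ β) {x x' : Vec d}
    {y : Vec d'} (hx : x ∈ X) (hx' : x' ∈ X) (hy : y ∈ Y) (z : Z) :
    |f x' y z - f x y z - inner ℝ (gradX f x y z) (x' - x)| ≤ β / 2 * ‖x' - x‖ ^ 2 :=
  abs_sub_sub_le_of_gradient_lipschitz (g := fun x' => f x' y z)
    (g' := fun x' => gradX f x' y z) hX (fun w hw => h.hasGradientAt_x hw hy z)
    (fun w hw w' hw' => by simpa using (h.lipschitz hβ hw hw' hy hy z).1) hx hx'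

theorem abs_sub_sub_le_y (h : IsSmoothOn β X Y f) (hY : Convex ℝ Y) (hβ : 0 ≤ β) {x : Vec d}
    {y y' : Vec d'} (hx : x ∈ X) (hy : y ∈ Y) (hy' : y' ∈ Y) (z : Z) :
    |f x y' z - f x y z - inner ℝ (gradY f x y z) (y' - y)| ≤ β / 2 * ‖y' - y‖ ^ 2 :=
  abs_sub_sub_le_of_gradient_lipschitz (g := fun y' => f x y' z)
    (g' := fun y' => gradY f x y' z) hY (fun w hw => h.hasGradientAt_y hx hw z)
    (fun w hw w' hw' => by simpa using (h.lipschitz hβ hx hx hw hw' z).2) hy hy'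

/-- A non-negative smooth function is self-bounding. -/
theorem norm_grad_sq_le (h : IsSmoothOn β Set.univ Set.univ f) (hβ : 0 < β)
    (h0 : ∀ x y z, 0 ≤ f x y z) (x : Vec d) (y : Vec d') (z : Z) :
    ‖gradX f x y z‖ ^ 2 ≤ 2 * β * f x y z ∧ ‖gradY f x y z‖ ^ 2 ≤ 2 * β * f x y z := by
  constructor
  -- The value after a gradient step of size `1/β` is still non-negative. This step may leave `X ×
  -- Y`, which is why smoothness on the whole space is required.
  · have h1 := (abs_le.1 (h.abs_sub_sub_le_x convex_univ hβ.le (Set.mem_univ x)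
      (Set.mem_univ (x - (1 / β) • gradX f x y z)) (Set.mem_univ y) z)).2
    rw [sub_sub_cancel_left, inner_neg_right, inner_smul_right, real_inner_self_eq_norm_sq,
      norm_neg, norm_smul, mul_pow, Real.norm_of_nonneg (by positivity)] at h1
    have h2 := h0 (x - (1 / β) • gradX f x y z) y z
    have e : β / 2 * ((1 / β) ^ 2 * ‖gradX f x y z‖ ^ 2) = 1 / β * ‖gradX f x y z‖ ^ 2 / 2 := by
      field_simp
    have h3 : ‖gradX f x y z‖ ^ 2 / (2 * β) ≤ f x y z := by
      have : ‖gradX f x y z‖ ^ 2 / (2 * β) = 1 / β * ‖gradX f x y z‖ ^ 2 / 2 := by field_simp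
      linarith
    rw [div_le_iff₀ (by positivity)] at h3
    linarith
  · have h1 := (abs_le.1 (h.abs_sub_sub_le_y convex_univ hβ.le (Set.mem_univ x)
      (Set.mem_univ y) (Set.mem_univ (y - (1 / β) • gradY f x y z)) z)).2
    rw [sub_sub_cancel_left, inner_neg_right, inner_smul_right, real_inner_self_eq_norm_sq,
      norm_neg, norm_smul, mul_pow, Real.norm_of_nonneg (by positivity)] at h1
    have h2 := h0 x (y - (1 / β) • gradY f x y z) z
    have e : β / 2 * ((1 / β) ^ 2 * ‖gradY f x y z‖ ^ 2) = 1 / β * ‖gradY f x y z‖ ^ 2 / 2 := by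
      field_simp
    have h3 : ‖gradY f x y z‖ ^ 2 / (2 * β) ≤ f x y z := by
      have : ‖gradY f x y z‖ ^ 2 / (2 * β) = 1 / β * ‖gradY f x y z‖ ^ 2 / 2 := by field_simp
      linarith
    rw [div_le_iff₀ (by positivity)] at h3
    linarith

end IsSmoothOn

variable {μx μy DX DY : ℝ}

theorem IsSCSC.isSaddleFunction (h : IsSCSC β μx μy DX DY X Y f) (hβ : 0 ≤ β) (z : Z) :
    IsSaddleFunction β μx μy X Y (fun x y => f x y z) (fun x y => gradX f x y z)
      (fun x y => gradY f x y z) where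
  strong_x x hx x' hx' y hy := (h.convex_x y hy z).2 x' hx' x hx
  strong_y x hx y hy y' hy' := by
    have h1 := (h.concave_y x hx z).2 y' hy' y hy
    rw [(hasGradientAt_neg (h.smooth.hasGradientAt_y hx hy z)).gradient, inner_neg_left] at h1
    linarith
  smooth_x x hx x' hx' y hy := by
    have := (abs_le.1 (h.smooth.abs_sub_sub_le_x h.convex_X hβ hx hx' hy z)).2
    linarith
  smooth_y x hx y hy y' hy' := by
    have := (abs_le.1 (h.smooth.abs_sub_sub_le_y h.convex_Y hβ hx hy hy' z)).1
    linarith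
  lip_x x hx x' hx' y hy y' hy' := (h.smooth.lipschitz hβ hx hx' hy hy' z).1
  lip_y x hx x' hx' y hy y' hy' := (h.smooth.lipschitz hβ hx hx' hy hy' z).2

theorem average_sub_le_inner {n : ℕ} (hn : 0 < n) {a b : Fin n → ℝ} {g : Fin n → Vec d}
    {v : Vec d} {c : ℝ} (h : ∀ i, a i - b i ≤ inner ℝ (g i) v + c) :
    1 / (n : ℝ) * ∑ i, a i - 1 / (n : ℝ) * ∑ i, b i ≤
      inner ℝ ((1 / (n : ℝ)) • ∑ i, g i) v + c := by
  have hn' : (0 : ℝ) < n := by exact_mod_cast hn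
  have h1 := Finset.sum_le_sum fun i (_ : i ∈ Finset.univ) => h i
  rw [Finset.sum_sub_distrib, Finset.sum_add_distrib, ← sum_inner, Finset.sum_const,
    Finset.card_univ, Fintype.card_fin, nsmul_eq_mul] at h1
  have h2 := mul_le_mul_of_nonneg_left h1 (show 0 ≤ 1 / (n : ℝ) by positivity)
  rw [real_inner_smul_left]
  have e : 1 / (n : ℝ) * (n * c) = c := by field_simp
  rw [mul_add, mul_sub, e] at h2
  exact h2

theorem inner_le_average_sub {n : ℕ} (hn : 0 < n) {a b : Fin n → ℝ} {g : Fin n → Vec d}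
    {v : Vec d} {c : ℝ} (h : ∀ i, inner ℝ (g i) v + c ≤ a i - b i) :
    inner ℝ ((1 / (n : ℝ)) • ∑ i, g i) v + c ≤
      1 / (n : ℝ) * ∑ i, a i - 1 / (n : ℝ) * ∑ i, b i := by
  have := average_sub_le_inner hn (a := b) (b := a) (g := fun i => -g i) (v := v) (c := -c)
    fun i => by rw [inner_neg_left]; linarith [h i]
  rw [Finset.sum_neg_distrib, smul_neg, inner_neg_left] at this
  linarith

theorem norm_average_sub_average_le {n : ℕ} (hn : 0 < n) {a b : Fin n → Vec d} {c : ℝ}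
    (h : ∀ i, ‖a i - b i‖ ≤ c) :
    ‖(1 / (n : ℝ)) • ∑ i, a i - (1 / (n : ℝ)) • ∑ i, b i‖ ≤ c := by
  have hn' : (0 : ℝ) < n := by exact_mod_cast hn
  rw [← smul_sub, ← Finset.sum_sub_distrib, norm_smul, Real.norm_of_nonneg (by positivity),
    one_div, inv_mul_le_iff₀ hn']
  refine (norm_sum_le_of_le _ fun i _ => h i).trans ?_
  simp

theorem IsSCSC.gradient_empRisk_x (h : IsSCSC β μx μy DX DY X Y f) {n : ℕ} (S : Fin n → Z)
    {x : Vec d} {y : Vec d'} (hx : x ∈ X) (hy : y ∈ Y) :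
    gradient (fun x' => empRisk f S x' y) x = (1 / (n : ℝ)) • ∑ i, gradX f x y (S i) :=
  (hasGradientAt_average _ fun i => h.smooth.hasGradientAt_x hx hy (S i)).gradient

theorem IsSCSC.gradient_empRisk_y (h : IsSCSC β μx μy DX DY X Y f) {n : ℕ} (S : Fin n → Z)
    {x : Vec d} {y : Vec d'} (hx : x ∈ X) (hy : y ∈ Y) :
    gradient (fun y' => empRisk f S x y') y = (1 / (n : ℝ)) • ∑ i, gradY f x y (S i) :=
  (hasGradientAt_average _ fun i => h.smooth.hasGradientAt_y hx hy (S i)).gradient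

theorem IsSCSC.isSaddleFunction_empRisk (h : IsSCSC β μx μy DX DY X Y f) (hβ : 0 ≤ β) {n : ℕ}
    (hn : 0 < n) (S : Fin n → Z) :
    IsSaddleFunction β μx μy X Y (empRisk f S) (fun x y => gradient (fun x' => empRisk f S x' y) x)
      (fun x y => gradient (fun y' => empRisk f S x y') y) where
  strong_x x hx x' hx' y hy := by
    simp only [h.gradient_empRisk_x S hx hy]
    exact inner_le_average_sub hn fun i => (h.isSaddleFunction hβ (S i)).strong_x x hx x' hx' y hy
  strong_y x hx y hy y' hy' := by
    simp only [h.gradient_empRisk_y S hx hy, sub_eq_add_neg (inner ℝ _ _)]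
    exact average_sub_le_inner hn fun i => by
      have := (h.isSaddleFunction hβ (S i)).strong_y x hx y hy y' hy'
      linarith
  smooth_x x hx x' hx' y hy := by
    simp only [h.gradient_empRisk_x S hx hy]
    exact average_sub_le_inner hn fun i => (h.isSaddleFunction hβ (S i)).smooth_x x hx x' hx' y hy
  smooth_y x hx y hy y' hy' := by
    simp only [h.gradient_empRisk_y S hx hy, sub_eq_add_neg (inner ℝ _ _)]
    exact inner_le_average_sub hn fun i => by
      have := (h.isSaddleFunction hβ (S i)).smooth_y x hx y hy y' hy'
      linarith
  lip_x x hx x' hx' y hy y' hy' := by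
    simp only [h.gradient_empRisk_x S hx hy, h.gradient_empRisk_x S hx' hy']
    exact norm_average_sub_average_le hn fun i =>
      (h.isSaddleFunction hβ (S i)).lip_x x hx x' hx' y hy y' hy'
  lip_y x hx x' hx' y hy y' hy' := by
    simp only [h.gradient_empRisk_y S hx hy, h.gradient_empRisk_y S hx' hy']
    exact norm_average_sub_average_le hn fun i =>
      (h.isSaddleFunction hβ (S i)).lip_y x hx x' hx' y hy y' hy'

end Bridge

/-! ### First-order conditions for the population problem and their use along the iterates. -/

section Population

/-- Half of the smoothness constant of the primal function. -/
def primalSmoothness (β μy : ℝ) : ℝ := (β + β ^ 2 / μy) / 2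

/-- The constant in the distance bound for the averaged iterate of the empirical problem. -/
def iterateBound (β μx μy DX DY : ℝ) : ℝ :=
  averageBound β (min μx (min μy β))
    (residualBound β μx (min μy β) (1 / (16 * (β / μy + 1) ^ 2 * β)) DX DY) DX

variable {d d' : ℕ} {Z : Type*} [MeasurableSpace Z] {P : Measure Z}
  {β μx μy Bx By DX DY R₁ : ℝ} {X : Set (Vec d)} {Y : Set (Vec d')}
  {f : Vec d → Vec d' → Z → ℝ} {xs : Vec d} {ys : Vec d'}

/-- The `+ 1` in the step size covers the case `β < μy`, where `min μy β = β`. -/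
theorem stepSize_condition (hβ : 0 < β) (hμy : 0 < μy) :
    7 * (β / min μy β) ^ 2 * (1 / (16 * (β / μy + 1) ^ 2 * β) * β) ≤ 1 := by
  have hκ : 0 < β / μy := by positivity
  have h1 : β / min μy β ≤ β / μy + 1 := by
    rcases le_total μy β with h | h
    · rw [min_eq_left h]; linarith
    · rw [min_eq_right h, div_self hβ.ne']; linarith
  have hm : 0 < min μy β := lt_min hμy hβ
  have h2 : (β / min μy β) ^ 2 ≤ (β / μy + 1) ^ 2 := by gcongr
  have e : 1 / (16 * (β / μy + 1) ^ 2 * β) * β = 1 / (16 * (β / μy + 1) ^ 2) := by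
    field_simp
  rw [e, mul_one_div, div_le_one (by positivity)]
  have : 0 ≤ (β / μy + 1) ^ 2 := by positivity
  linarith

namespace Setting

theorem primal_eq (h : Setting β μx μy Bx By DX DY R₁ P X Y f xs ys) :
    primal P Y f xs = popRisk P f xs ys := by
  refine IsGreatest.csSup_eq ⟨⟨ys, h.solution.mem_Y, rfl⟩, ?_⟩
  rintro _ ⟨y, hy, rfl⟩
  exact h.solution.isMax hy

theorem residual_empRisk_le (h : Setting β μx μy Bx By DX DY R₁ P X Y f xs ys) (hβ : 0 < β)
    (hμx : 0 < μx) (hμy : 0 < μy) {n : ℕ} (hn : 0 < n) {S : Fin n → Z} {N : ℕ}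
    (hS : StaysInDomain β μy X Y f S (N + 2)) :
    ∑ t ∈ Finset.range (N + 1),
      (‖gradient (fun x => empRisk f S x (gdaIter β μy f S t).2) (gdaIter β μy f S t).1‖ +
        ‖gradient (fun y => empRisk f S (gdaIter β μy f S t).1 y) (gdaIter β μy f S t).2‖) ≤
        residualBound β μx (min μy β) (1 / (16 * (β / μy + 1) ^ 2 * β)) DX DY ∧
      (N + 1) *
      (‖gradient (fun x => empRisk f S x (gdaIter β μy f S N).2) (gdaIter β μy f S N).1‖ +
        ‖gradient (fun y => empRisk f S (gdaIter β μy f S N).1 y) (gdaIter β μy f S N).2‖) ≤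
        residualBound β μx (min μy β) (1 / (16 * (β / μy + 1) ^ 2 * β)) DX DY :=
  ((h.scsc.isSaddleFunction_empRisk hβ.le hn S).mono (min_le_left μy β)).residual_le
    h.scsc.convex_Y h.scsc.compact_Y h.scsc.bound_X h.scsc.bound_Y hβ hμx (lt_min hμy hβ)
    (min_le_right _ _) (by positivity) (stepSize_condition hβ hμy)
    (x := fun t => (gdaIter β μy f S t).1) (y := fun t => (gdaIter β μy f S t).2)
    (fun t => rfl) (fun t => rfl) (fun t ht => (hS t (by omega)).1)
    (fun t ht => (hS t (by omega)).2)

theorem gdaAvg_mem (h : Setting β μx μy Bx By DX DY R₁ P X Y f xs ys) {n : ℕ} {S : Fin n → Z}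
    {T : ℕ} (hT : 0 < T) (hS : StaysInDomain β μy X Y f S T) : gdaAvg β μy f S T ∈ X := by
  have hT' : (0 : ℝ) < T := by exact_mod_cast hT
  rw [gdaAvg, Finset.smul_sum]
  refine h.scsc.convex_X.sum_mem (fun _ _ => by positivity) ?_
    fun t ht => (hS t (Finset.mem_range.1 ht)).1
  simp [hT'.ne']

theorem norm_sub_sq_le (h : Setting β μx μy Bx By DX DY R₁ P X Y f xs ys) {x : Vec d}
    (hx : x ∈ X) : ‖x - xs‖ ^ 2 ≤ 4 * DX :=
  norm_sub_sq_le_of_sq_le (h.scsc.bound_X x hx) (h.scsc.bound_X xs h.solution.mem_X)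

variable [IsProbabilityMeasure P]

theorem integrable_inner_x (h : Setting β μx μy Bx By DX DY R₁ P X Y f xs ys) (v : Vec d) :
    Integrable (fun z => inner ℝ (gradX f xs ys z) v) P := h.bernstein_x.integrable.inner_const v

theorem integral_inner_x (h : Setting β μx μy Bx By DX DY R₁ P X Y f xs ys) (v : Vec d) :
    ∫ z, inner ℝ (gradX f xs ys z) v ∂P = inner ℝ (∫ z, gradX f xs ys z ∂P) v := by
  simp_rw [real_inner_comm v]
  exact integral_inner h.bernstein_x.integrable v

theorem integrable_inner_y (h : Setting β μx μy Bx By DX DY R₁ P X Y f xs ys) (v : Vec d') :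
    Integrable (fun z => inner ℝ (gradY f xs ys z) v) P := h.bernstein_y.integrable.inner_const v

theorem integral_inner_y (h : Setting β μx μy Bx By DX DY R₁ P X Y f xs ys) (v : Vec d') :
    ∫ z, inner ℝ (gradY f xs ys z) v ∂P = inner ℝ (∫ z, gradY f xs ys z ∂P) v := by
  simp_rw [real_inner_comm v]
  exact integral_inner h.bernstein_y.integrable v

/-- The inequality is integrated pointwise in `z`. Only gradients at `(xs, ys)` appear, and the
Bernstein condition makes these integrable, so no differentiation under the integral is needed. -/
theorem popRisk_le (h : Setting β μx μy Bx By DX DY R₁ P X Y f xs ys) (hβ : 0 < β)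
    (hμy : 0 < μy) {x : Vec d} {y : Vec d'} (hx : x ∈ X) (hy : y ∈ Y) :
    popRisk P f x y ≤ popRisk P f xs ys + inner ℝ (∫ z, gradX f xs ys z ∂P) (x - xs) +
      inner ℝ (∫ z, gradY f xs ys z ∂P) (y - ys) + primalSmoothness β μy * ‖x - xs‖ ^ 2 := by
  have hX := h.solution.mem_X
  have hY := h.solution.mem_Y
  have i0 := h.integrable xs hX ys hY
  have i1 := h.integrable_inner_x (x - xs)
  have i2 := h.integrable_inner_y (y - ys)
  have key : popRisk P f x y ≤ ∫ z, (f xs ys z + inner ℝ (gradX f xs ys z) (x - xs) +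
      inner ℝ (gradY f xs ys z) (y - ys) + primalSmoothness β μy * ‖x - xs‖ ^ 2) ∂P := by
    refine integral_mono (h.integrable x hx y hy)
      (((i0.add i1).add i2).add (integrable_const _)) fun z => ?_
    exact (h.scsc.isSaddleFunction hβ.le z).le_add_inner_add_inner hμy hX hx hY hy
  have e1 := integral_add ((i0.add i1).add i2)
    (integrable_const (primalSmoothness β μy * ‖x - xs‖ ^ 2))
  have e2 := integral_add (i0.add i1) i2
  have e3 := integral_add i0 i1
  simp only [Pi.add_apply] at e1 e2 e3
  rw [e1, e2, e3, h.integral_inner_x, h.integral_inner_y] at key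
  simpa [popRisk] using key

theorem le_popRisk (h : Setting β μx μy Bx By DX DY R₁ P X Y f xs ys) (hβ : 0 < β)
    {y : Vec d'} (hy : y ∈ Y) :
    popRisk P f xs ys + inner ℝ (∫ z, gradY f xs ys z ∂P) (y - ys) - β / 2 * ‖y - ys‖ ^ 2 ≤
      popRisk P f xs y := by
  have hX := h.solution.mem_X
  have hY := h.solution.mem_Y
  have i0 := h.integrable xs hX ys hY
  have i2 := h.integrable_inner_y (y - ys)
  have key : ∫ z, (f xs ys z + inner ℝ (gradY f xs ys z) (y - ys) - β / 2 * ‖y - ys‖ ^ 2) ∂P ≤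
      popRisk P f xs y := by
    refine integral_mono ((i0.add i2).sub (integrable_const _)) (h.integrable xs hX y hy)
      fun z => ?_
    have := (h.scsc.isSaddleFunction hβ.le z).smooth_y xs hX ys hY y hy
    dsimp only
    linarith
  have e1 := integral_sub (i0.add i2) (integrable_const (β / 2 * ‖y - ys‖ ^ 2))
  have e2 := integral_add i0 i2
  simp only [Pi.add_apply] at e1 e2
  rw [e1, e2, h.integral_inner_y] at key
  simpa [popRisk] using key

theorem inner_gradY_le (h : Setting β μx μy Bx By DX DY R₁ P X Y f xs ys) (hβ : 0 < β)
    {y : Vec d'} (hy : y ∈ Y) : inner ℝ (∫ z, gradY f xs ys z ∂P) (y - ys) ≤ 0 := by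
  refine nonpos_of_mul_le_sq_mul (b := β / 2 * ‖y - ys‖ ^ 2) fun s hs hs1 => ?_
  have hmem : ys + s • (y - ys) ∈ Y :=
    h.scsc.convex_Y.add_smul_sub_mem h.solution.mem_Y hy ⟨hs.le, hs1⟩
  have h1 := h.le_popRisk hβ hmem
  have h2 : popRisk P f xs (ys + s • (y - ys)) ≤ popRisk P f xs ys := h.solution.isMax hmem
  rw [add_sub_cancel_left, inner_smul_right, norm_smul, mul_pow, Real.norm_of_nonneg hs.le] at h1
  linarith

theorem primal_le (h : Setting β μx μy Bx By DX DY R₁ P X Y f xs ys) (hβ : 0 < β)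
    (hμy : 0 < μy) {x : Vec d} (hx : x ∈ X) :
    primal P Y f x ≤ primal P Y f xs + inner ℝ (∫ z, gradX f xs ys z ∂P) (x - xs) +
      primalSmoothness β μy * ‖x - xs‖ ^ 2 := by
  refine csSup_le ⟨_, ⟨ys, h.solution.mem_Y, rfl⟩⟩ ?_
  rintro _ ⟨y, hy, rfl⟩
  rw [h.primal_eq]
  linarith [h.popRisk_le hβ hμy hx hy, h.inner_gradY_le hβ hy]

/-- Minimality of `xs` is tested against the quadratic upper bound for the primal function, without
differentiating that function. -/
theorem inner_gradX_nonneg (h : Setting β μx μy Bx By DX DY R₁ P X Y f xs ys) (hβ : 0 < β)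
    (hμy : 0 < μy) {x : Vec d} (hx : x ∈ X) :
    0 ≤ inner ℝ (∫ z, gradX f xs ys z ∂P) (x - xs) := by
  rw [← neg_nonpos]
  refine nonpos_of_mul_le_sq_mul (b := primalSmoothness β μy * ‖x - xs‖ ^ 2) fun s hs hs1 => ?_
  have hmem : xs + s • (x - xs) ∈ X :=
    h.scsc.convex_X.add_smul_sub_mem h.solution.mem_X hx ⟨hs.le, hs1⟩
  have h1 := h.primal_le hβ hμy hmem
  have h2 : primal P Y f xs ≤ primal P Y f (xs + s • (x - xs)) := h.solution.isMin hmem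
  rw [add_sub_cancel_left, inner_smul_right, norm_smul, mul_pow, Real.norm_of_nonneg hs.le] at h1
  linarith

theorem norm_gdaAvg_sub_le (h : Setting β μx μy Bx By DX DY R₁ P X Y f xs ys) (hβ : 0 < β)
    (hμx : 0 < μx) (hμy : 0 < μy) {n : ℕ} (hn : 0 < n) {S : Fin n → Z} {N : ℕ}
    (hS : StaysInDomain β μy X Y f S (N + 2)) {e : ℝ} (he : 0 ≤ e)
    (hX : ∀ x ∈ X, |inner ℝ ((1 / (n : ℝ)) • ∑ i, gradX f xs ys (S i) -
      ∫ z, gradX f xs ys z ∂P) (x - xs)| ≤ e * ‖x - xs‖)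
    (hY : ∀ y ∈ Y, |inner ℝ ((1 / (n : ℝ)) • ∑ i, gradY f xs ys (S i) -
      ∫ z, gradY f xs ys z ∂P) (y - ys)| ≤ e * ‖y - ys‖) :
    ‖gdaAvg β μy f S (N + 2) - xs‖ ≤
      iterateBound β μx μy DX DY * (e + 1 / ((N + 2 : ℕ) : ℝ)) := by
  have hsum := (h.residual_empRisk_le hβ hμx hμy hn hS).1
  have hm : 0 < min μy β := lt_min hμy hβ
  rw [← h.scsc.gradient_empRisk_x S h.solution.mem_X h.solution.mem_Y] at hX
  rw [← h.scsc.gradient_empRisk_y S h.solution.mem_X h.solution.mem_Y] at hY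
  exact ((h.scsc.isSaddleFunction_empRisk hβ.le hn S).mono (min_le_left μy β)).norm_average_sub_le
    (min_le_left _ _) (min_le_right _ _) (lt_min hμx hm) hβ h.scsc.bound_X
    (residualBound_nonneg hβ hμx hm (by positivity)) he h.solution.mem_X h.solution.mem_Y
    (fun x hx => h.inner_gradX_nonneg hβ hμy hx) (fun y hy => h.inner_gradY_le hβ hy) hX hY
    (x := fun t => (gdaIter β μy f S t).1) (y := fun t => (gdaIter β μy f S t).2)
    (fun t ht => (hS t (by omega)).1) (fun t ht => (hS t (by omega)).2) hsum

theorem norm_integral_gradX_le (h : Setting β μx μy Bx By DX DY R₁ P X Y f xs ys) (hβ : 0 < β)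
    (hμx : 0 < μx) (hμy : 0 < μy) {n : ℕ} (hn : 0 < n) {S : Fin n → Z} {N : ℕ}
    (hS : StaysInDomain β μy X Y f S (N + 2)) {e : ℝ}
    (hX : ‖(1 / (n : ℝ)) • ∑ i, gradX f xs ys (S i) - ∫ z, gradX f xs ys z ∂P‖ ≤ e)
    (hY : ‖(1 / (n : ℝ)) • ∑ i, gradY f xs ys (S i) - ∫ z, gradY f xs ys z ∂P‖ ≤ e) :
    ‖∫ z, gradX f xs ys z ∂P‖ ≤ iterateBound β μx μy DX DY * (e + 1 / ((N + 2 : ℕ) : ℝ)) := by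
  have hN := (h.residual_empRisk_le hβ hμx hμy hn hS).2
  have hm : 0 < min μy β := lt_min hμy hβ
  have hSN := hS N (by omega)
  have he : 0 ≤ e := (norm_nonneg _).trans hX
  rw [← h.scsc.gradient_empRisk_x S h.solution.mem_X h.solution.mem_Y] at hX
  rw [← h.scsc.gradient_empRisk_y S h.solution.mem_X h.solution.mem_Y] at hY
  exact ((h.scsc.isSaddleFunction_empRisk hβ.le hn S).mono (min_le_left μy β)).norm_gradient_le
    (min_le_left _ _) (min_le_right _ _) (lt_min hμx hm) hβ
    (residualBound_nonneg hβ hμx hm (by positivity)) he hSN.1 h.solution.mem_X hSN.2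
    h.solution.mem_Y (h.inner_gradX_nonneg hβ hμy hSN.1) (h.inner_gradY_le hβ hSN.2) hX hY hN

end Setting

end Population

/-! ### The high-probability excess risk bound. -/

section Rates

/-- The constant in the rate of gradient descent ascent. -/
def rateBound (β μx μy Bx By DX DY a : ℝ) : ℝ :=
  2 * (1 + primalSmoothness β μy) * iterateBound β μx μy DX DY ^ 2 *
      (128 * (Bx ^ 2 + By ^ 2) + 32 + 1 / a ^ 2) +
    -- This summand serves `T = 1`, the preceding one `T ≥ 2`.
    (√DX + 4 * primalSmoothness β μy * DX) * (1 / a + 1 / a ^ 2)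

theorem rateBound_pos {β μx μy Bx By DX DY a : ℝ} (hβ : 0 < β) (hμy : 0 < μy) (hDX : 0 < DX)
    (ha : 0 < a) : 0 < rateBound β μx μy Bx By DX DY a := by
  unfold rateBound primalSmoothness; positivity

theorem one_le_log_eight_div {δ : ℝ} (hδ : 0 < δ) (hδ1 : δ < 1) : 1 ≤ Real.log (8 / δ) := by
  rw [Real.le_log_iff_exp_le (by positivity), le_div_iff₀ hδ]
  have := Real.exp_one_lt_d9
  have := Real.exp_pos 1
  nlinarith

variable {d d' : ℕ} {Z : Type*} [MeasurableSpace Z] {P : Measure Z}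
  {β μx μy Bx By DX DY R₁ : ℝ} {X : Set (Vec d)} {Y : Set (Vec d')}
  {f : Vec d → Vec d' → Z → ℝ} {xs : Vec d} {ys : Vec d'}

theorem quadratic_le_rate {g r L Q e w V B u a : ℝ} (hL : 0 ≤ L) (ha : 0 < a) (hu : 0 ≤ u)
    (hV : 0 ≤ V) (hB : 0 ≤ B) (hg0 : 0 ≤ g) (hr0 : 0 ≤ r) (hw : 0 ≤ w)
    (hwu : w ≤ u / a) (hg : g ≤ Q * (e + w)) (hr : r ≤ Q * (e + w))
    (he2 : e ^ 2 = 128 * B * u ^ 2 + 32 * V * u) :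
    g * r + L * r ^ 2 ≤ 2 * (1 + L) * Q ^ 2 * (128 * B + 32 + 1 / a ^ 2) * (V * u + u ^ 2) := by
  have h1 : g * r + L * r ^ 2 ≤ (1 + L) * (Q * (e + w)) ^ 2 := by
    have a1 : g * r ≤ Q * (e + w) * (Q * (e + w)) := mul_le_mul hg hr hr0 (hg0.trans hg)
    have a2 : r ^ 2 ≤ (Q * (e + w)) ^ 2 := by gcongr
    have a3 := mul_le_mul_of_nonneg_left a2 hL
    linarith
  have h2 : (e + w) ^ 2 ≤ 2 * ((128 * B + 32 + 1 / a ^ 2) * (V * u + u ^ 2)) := by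
    have a1 : w ^ 2 ≤ (u / a) ^ 2 := by gcongr
    have a2 : (128 * B + 32 + 1 / a ^ 2) * (V * u + u ^ 2) =
      e ^ 2 + (u / a) ^ 2 + ((128 * B + 1 / a ^ 2) * (V * u) + 32 * u ^ 2) := by
      rw [he2]; field_simp; ring
    have a3 : 0 ≤ (128 * B + 1 / a ^ 2) * (V * u) + 32 * u ^ 2 := by positivity
    rw [a2]
    nlinarith [sq_nonneg (e - w)]
  calc g * r + L * r ^ 2 ≤ (1 + L) * (Q * (e + w)) ^ 2 := h1
    _ = (1 + L) * Q ^ 2 * (e + w) ^ 2 := by ring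
    _ ≤ (1 + L) * Q ^ 2 * (2 * ((128 * B + 32 + 1 / a ^ 2) * (V * u + u ^ 2))) :=
      mul_le_mul_of_nonneg_left h2 (by positivity)
    _ = _ := by ring

/-- The deviations at `(xs, ys)` of the empirical gradients of `S` obey Bernstein's inequality
at the scale `u`. -/
def GradientsConcentrate (P : Measure Z) (f : Vec d → Vec d' → Z → ℝ) (xs : Vec d) (ys : Vec d')
    (Bx By u : ℝ) {n : ℕ} (S : Fin n → Z) : Prop :=
  ‖(1 / (n : ℝ)) • ∑ i, gradX f xs ys (S i) - ∫ z, gradX f xs ys z ∂P‖ ^ 2 ≤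
      128 * Bx ^ 2 * u ^ 2 + 32 * (∫ z, ‖gradX f xs ys z‖ ^ 2 ∂P) * u ∧
    ‖(1 / (n : ℝ)) • ∑ i, gradY f xs ys (S i) - ∫ z, gradY f xs ys z ∂P‖ ^ 2 ≤
      128 * By ^ 2 * u ^ 2 + 32 * (∫ z, ‖gradY f xs ys z‖ ^ 2 ∂P) * u

theorem GradientsConcentrate.exists_deviation {n : ℕ} {S : Fin n → Z} {u : ℝ} (hu : 0 ≤ u)
    (hS : GradientsConcentrate P f xs ys Bx By u S) :
    ∃ e : ℝ, 0 ≤ e ∧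
      ‖(1 / (n : ℝ)) • ∑ i, gradX f xs ys (S i) - ∫ z, gradX f xs ys z ∂P‖ ≤ e ∧
      ‖(1 / (n : ℝ)) • ∑ i, gradY f xs ys (S i) - ∫ z, gradY f xs ys z ∂P‖ ≤ e ∧
      e ^ 2 = 128 * (Bx ^ 2 + By ^ 2) * u ^ 2 + 32 * ((∫ z, ‖gradX f xs ys z‖ ^ 2 ∂P) +
        ∫ z, ‖gradY f xs ys z‖ ^ 2 ∂P) * u := by
  obtain ⟨h1, h2⟩ := hS
  have hVx : 0 ≤ ∫ z, ‖gradX f xs ys z‖ ^ 2 ∂P := integral_nonneg fun z => by positivity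
  have hVy : 0 ≤ ∫ z, ‖gradY f xs ys z‖ ^ 2 ∂P := integral_nonneg fun z => by positivity
  set Vx := ∫ z, ‖gradX f xs ys z‖ ^ 2 ∂P
  set Vy := ∫ z, ‖gradY f xs ys z‖ ^ 2 ∂P
  have a1 : 0 ≤ 128 * By ^ 2 * u ^ 2 + 32 * Vy * u := by positivity
  have a2 : 0 ≤ 128 * Bx ^ 2 * u ^ 2 + 32 * Vx * u := by positivity
  refine ⟨√(128 * (Bx ^ 2 + By ^ 2) * u ^ 2 + 32 * (Vx + Vy) * u), Real.sqrt_nonneg _,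
    Real.le_sqrt_of_sq_le (by linarith), Real.le_sqrt_of_sq_le (by linarith),
    Real.sq_sqrt (by positivity)⟩

/-- Self-bounding is integrated at `(xs, ys)`, where the mean of `f` is the optimal primal value. -/
theorem Setting.integral_norm_grad_sq_le (h : Setting β μx μy Bx By DX DY R₁ P X Y f xs ys)
    (hβ : 0 < β) (hs : IsSmoothOn β Set.univ Set.univ f) (h0 : ∀ x y z, 0 ≤ f x y z) :
    (∫ z, ‖gradX f xs ys z‖ ^ 2 ∂P) + ∫ z, ‖gradY f xs ys z‖ ^ 2 ∂P ≤
      4 * β * primal P Y f xs := by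
  have hi := (h.integrable xs h.solution.mem_X ys h.solution.mem_Y).const_mul (2 * β)
  have h1 := integral_mono (h.bernstein_x.2 2 le_rfl).1 hi
    fun z => (hs.norm_grad_sq_le hβ h0 xs ys z).1
  have h2 := integral_mono (h.bernstein_y.2 2 le_rfl).1 hi
    fun z => (hs.norm_grad_sq_le hβ h0 xs ys z).2
  rw [integral_const_mul] at h1 h2
  rw [h.primal_eq, popRisk]
  linarith

theorem Setting.primal_nonneg (h : Setting β μx μy Bx By DX DY R₁ P X Y f xs ys)
    (h0 : ∀ x ∈ X, ∀ y ∈ Y, ∀ z, 0 ≤ f x y z) : 0 ≤ primal P Y f xs := by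
  rw [h.primal_eq]
  exact integral_nonneg fun z => h0 _ h.solution.mem_X _ h.solution.mem_Y z

variable [IsProbabilityMeasure P]

theorem ExcessRiskBound.mono {n T : ℕ} {δ ε ε' : ℝ}
    (h : ExcessRiskBound β μy P X Y f xs n T δ ε) (hε : ε ≤ ε') :
    ExcessRiskBound β μy P X Y f xs n T δ ε' := by
  obtain ⟨A, hA, hP, hS⟩ := h
  exact ⟨A, hA, hP, fun S hSA hD => (hS S hSA hD).trans hε⟩

namespace Setting

theorem exists_event (h : Setting β μx μy Bx By DX DY R₁ P X Y f xs ys) (hBx : 0 < Bx)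
    (hBy : 0 < By) {δ : ℝ} (hδ : 0 < δ) (hδ1 : δ < 1) {n : ℕ} (hn : 0 < n) :
    ∃ A : Set (Fin n → Z), MeasurableSet A ∧
      ENNReal.ofReal (1 - δ) ≤ Measure.pi (fun _ : Fin n => P) A ∧
      ∀ S ∈ A, GradientsConcentrate P f xs ys Bx By (Real.log (8 / δ) / n) S := by
  obtain ⟨A₁, m₁, p₁, h₁⟩ := h.bernstein_x.exists_event hBx hδ hδ1 hn
  obtain ⟨A₂, m₂, p₂, h₂⟩ := h.bernstein_y.exists_event hBy hδ hδ1 hn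
  refine ⟨A₁ ∩ A₂, m₁.inter m₂, ?_, fun S hS => ⟨h₁ S hS.1, h₂ S hS.2⟩⟩
  have hc : Measure.pi (fun _ : Fin n => P) (A₁ ∩ A₂)ᶜ ≤ ENNReal.ofReal δ := by
    rw [Set.compl_inter]
    refine (measure_union_le _ _).trans ((add_le_add p₁ p₂).trans ?_)
    rw [← ENNReal.ofReal_add (by positivity) (by positivity)]
    exact ENNReal.ofReal_le_ofReal (by linarith)
  rw [prob_compl_eq_one_sub (m₁.inter m₂)] at hc
  rw [ENNReal.ofReal_sub _ hδ.le, ENNReal.ofReal_one]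
  exact tsub_le_iff_tsub_le.1 hc

theorem excess_le_of_norm_le (h : Setting β μx μy Bx By DX DY R₁ P X Y f xs ys) (hβ : 0 < β)
    (hμy : 0 < μy) {x : Vec d} (hx : x ∈ X) :
    primal P Y f x - primal P Y f xs ≤
      ‖∫ z, gradX f xs ys z ∂P‖ * ‖x - xs‖ + primalSmoothness β μy * ‖x - xs‖ ^ 2 := by
  linarith [h.primal_le hβ hμy hx, real_inner_le_norm (∫ z, gradX f xs ys z ∂P) (x - xs)]

theorem excess_le_diam (h : Setting β μx μy Bx By DX DY R₁ P X Y f xs ys) (hβ : 0 < β)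
    (hμy : 0 < μy) (hDX : 0 < DX) {x : Vec d} (hx : x ∈ X) :
    primal P Y f x - primal P Y f xs ≤ (√DX + 4 * primalSmoothness β μy * DX) *
      (1 + ∫ z, ‖gradX f xs ys z‖ ^ 2 ∂P) := by
  have h1 := h.excess_le_of_norm_le hβ hμy hx
  have h2 := h.norm_sub_sq_le hx
  have h3 := h.bernstein_x.norm_integral_le
  have h4 : ‖x - xs‖ ≤ 2 * √DX := by
    refine abs_le_of_sq_le_sq' ?_ (by positivity) |>.2
    rw [mul_pow, Real.sq_sqrt hDX.le]; linarith
  set V := ∫ z, ‖gradX f xs ys z‖ ^ 2 ∂P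
  have hV : 0 ≤ V := integral_nonneg fun z => by positivity
  have hL : 0 ≤ primalSmoothness β μy := by unfold primalSmoothness; positivity
  have h5 : ‖∫ z, gradX f xs ys z ∂P‖ * ‖x - xs‖ ≤ (1 + V) / 2 * (2 * √DX) := by gcongr
  have h6 := mul_le_mul_of_nonneg_left h2 hL
  have h7 : 0 ≤ primalSmoothness β μy * DX * V := by positivity
  nlinarith

theorem excess_le (h : Setting β μx μy Bx By DX DY R₁ P X Y f xs ys) (hβ : 0 < β)
    (hμx : 0 < μx) (hμy : 0 < μy) (hDX : 0 < DX) {a : ℝ} (ha : 0 < a) {n T : ℕ} (hn : 0 < n)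
    (hT : a * n ≤ T) {u : ℝ} (hu : 1 / (n : ℝ) ≤ u) {S : Fin n → Z}
    (hS : GradientsConcentrate P f xs ys Bx By u S) (hD : StaysInDomain β μy X Y f S T) :
    primal P Y f (gdaAvg β μy f S T) - primal P Y f xs ≤ rateBound β μx μy Bx By DX DY a *
      (((∫ z, ‖gradX f xs ys z‖ ^ 2 ∂P) + ∫ z, ‖gradY f xs ys z‖ ^ 2 ∂P) * u + u ^ 2) := by
  have hn' : (0 : ℝ) < n := by exact_mod_cast hn
  have hu0 : 0 < u := lt_of_lt_of_le (by positivity) hu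
  have hT0 : (0 : ℝ) < T := lt_of_lt_of_le (by positivity) hT
  have hTu : 1 / (T : ℝ) ≤ u / a := by
    rw [div_le_div_iff₀ hT0 ha]
    rw [div_le_iff₀ hn'] at hu
    nlinarith
  obtain ⟨e, he, heX, heY, he2⟩ := hS.exists_deviation hu0.le
  have hmem := h.gdaAvg_mem (by exact_mod_cast hT0) hD
  have hVx : 0 ≤ ∫ z, ‖gradX f xs ys z‖ ^ 2 ∂P := integral_nonneg fun z => by positivity
  have hVy : 0 ≤ ∫ z, ‖gradY f xs ys z‖ ^ 2 ∂P := integral_nonneg fun z => by positivity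
  have hdiam := h.excess_le_diam hβ hμy hDX hmem
  have hsub := h.excess_le_of_norm_le hβ hμy hmem
  set Vx := ∫ z, ‖gradX f xs ys z‖ ^ 2 ∂P
  set Vy := ∫ z, ‖gradY f xs ys z‖ ^ 2 ∂P
  have hL : 0 ≤ primalSmoothness β μy := by unfold primalSmoothness; positivity
  set L := primalSmoothness β μy
  have hC1 : 0 ≤ √DX + 4 * L * DX := by positivity
  have hr : 0 ≤ (Vx + Vy) * u + u ^ 2 := by positivity
  obtain rfl | ⟨N, rfl⟩ : T = 1 ∨ ∃ N, T = N + 2 := by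
    have : 0 < T := by exact_mod_cast hT0
    rcases T with _ | _ | N
    · omega
    · exact Or.inl rfl
    · exact Or.inr ⟨N, rfl⟩
  -- With one iterate nothing has been optimized, but then `a * n ≤ 1` and hence `u ≥ a`, so a
  -- diameter bound is already of the required order.
  · have h1 : 1 ≤ u / a := by simpa using hTu
    have h2 : 1 + Vx ≤ (1 / a + 1 / a ^ 2) * ((Vx + Vy) * u + u ^ 2) := by
      have e1 : (1 / a + 1 / a ^ 2) * ((Vx + Vy) * u + u ^ 2) = (Vx + Vy) * (u / a) + (u / a) ^ 2 +
        (u ^ 2 / a + (Vx + Vy) * u / a ^ 2) := by field_simp; ring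
      have e2 : 0 ≤ u ^ 2 / a + (Vx + Vy) * u / a ^ 2 := by positivity
      rw [e1]
      nlinarith [mul_nonneg (add_nonneg hVx hVy) (sub_nonneg.2 h1)]
    refine hdiam.trans ((mul_le_mul_of_nonneg_left h2 hC1).trans ?_)
    rw [← mul_assoc]
    refine mul_le_mul_of_nonneg_right ?_ hr
    rw [rateBound]
    exact le_add_of_nonneg_left (by positivity)
  · have hx := h.norm_gdaAvg_sub_le hβ hμx hμy hn hD he
      (fun x _ => (abs_real_inner_le_norm _ _).trans (by gcongr))
      (fun y _ => (abs_real_inner_le_norm _ _).trans (by gcongr))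
    have hG := h.norm_integral_gradX_le hβ hμx hμy hn hD heX heY
    refine hsub.trans ((quadratic_le_rate hL ha hu0.le (add_nonneg hVx hVy) (by positivity)
      (norm_nonneg _) (norm_nonneg _) (by positivity) hTu hG hx he2).trans ?_)
    refine mul_le_mul_of_nonneg_right ?_ hr
    rw [rateBound]
    exact le_add_of_nonneg_right (by positivity)

theorem excessRiskBound (h : Setting β μx μy Bx By DX DY R₁ P X Y f xs ys) (hβ : 0 < β)
    (hμx : 0 < μx) (hμy : 0 < μy) (hBx : 0 < Bx) (hBy : 0 < By) (hDX : 0 < DX) {a : ℝ}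
    (ha : 0 < a) {δ : ℝ} (hδ : 0 < δ) (hδ1 : δ < 1) {n T : ℕ} (hn : 0 < n) (hT : a * n ≤ T) :
    ExcessRiskBound β μy P X Y f xs n T δ (rateBound β μx μy Bx By DX DY a *
      (((∫ z, ‖gradX f xs ys z‖ ^ 2 ∂P) + ∫ z, ‖gradY f xs ys z‖ ^ 2 ∂P) *
        (Real.log (8 / δ) / n) + (Real.log (8 / δ) / n) ^ 2)) := by
  obtain ⟨A, hA, hP, hS⟩ := h.exists_event hBx hBy hδ hδ1 hn
  exact ⟨A, hA, hP, fun S hSA hD => h.excess_le hβ hμx hμy hDX ha hn hT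
    (by gcongr; exact one_le_log_eight_div hδ hδ1) (hS S hSA) hD⟩

/-- The non-negative function `F(xs, ·)` has maximum zero, so it vanishes on `Y`, while strong
concavity makes it negative away from `ys`. -/
theorem eq_of_primal_eq_zero (h : Setting β μx μy Bx By DX DY R₁ P X Y f xs ys) (hβ : 0 < β)
    (hμy : 0 < μy) (h0 : ∀ x ∈ X, ∀ y ∈ Y, ∀ z, 0 ≤ f x y z) (hΦ : primal P Y f xs = 0)
    {y : Vec d'} (hy : y ∈ Y) : y = ys := by
  have hX := h.solution.mem_X
  have hY := h.solution.mem_Y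
  have i0 := h.integrable xs hX ys hY
  have i2 := h.integrable_inner_y (y - ys)
  have key : popRisk P f xs y ≤
      ∫ z, (f xs ys z + inner ℝ (gradY f xs ys z) (y - ys) - μy / 2 * ‖y - ys‖ ^ 2) ∂P := by
    refine integral_mono (h.integrable xs hX y hy) ((i0.add i2).sub (integrable_const _))
      fun z => ?_
    have := (h.scsc.isSaddleFunction hβ.le z).strong_y xs hX ys hY y hy
    dsimp only
    linarith
  have e1 := integral_sub (i0.add i2) (integrable_const (μy / 2 * ‖y - ys‖ ^ 2))
  have e2 := integral_add i0 i2
  simp only [Pi.add_apply] at e1 e2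
  rw [e1, e2, h.integral_inner_y] at key
  rw [h.primal_eq, popRisk] at hΦ
  have h1 : 0 ≤ popRisk P f xs y := integral_nonneg fun z => h0 _ hX _ hy z
  have h2 := h.inner_gradY_le hβ hy
  simp only [integral_const, probReal_univ, smul_eq_mul, one_mul] at key
  have h3 : ‖y - ys‖ ^ 2 ≤ 0 := by
    have : μy / 2 * ‖y - ys‖ ^ 2 ≤ 0 := by linarith
    by_contra! hc
    have : 0 < μy / 2 * ‖y - ys‖ ^ 2 := by positivity
    linarith
  exact sub_eq_zero.1 (norm_eq_zero.1 (pow_eq_zero_iff two_ne_zero |>.1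
    (le_antisymm h3 (sq_nonneg _))))

/-- Almost every `f(·, ys; z)` vanishes at `xs`, so it is minimal there and its directional
derivatives into `X` are non-negative. Their mean is zero, so they vanish almost surely. -/
theorem ae_inner_gradX_eq_zero (h : Setting β μx μy Bx By DX DY R₁ P X Y f xs ys) (hβ : 0 < β)
    (h0 : ∀ x ∈ X, ∀ y ∈ Y, ∀ z, 0 ≤ f x y z) (hΦ : primal P Y f xs = 0)
    (hG : ∫ z, gradX f xs ys z ∂P = 0) :
    ∀ᵐ z ∂P, ∀ x ∈ X, inner ℝ (gradX f xs ys z) (x - xs) = 0 := by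
  have hX := h.solution.mem_X
  have hY := h.solution.mem_Y
  rw [h.primal_eq, popRisk,
    integral_eq_zero_iff_of_nonneg (fun z => h0 _ hX _ hY z) (h.integrable xs hX ys hY)] at hΦ
  have hnn : ∀ᵐ z ∂P, ∀ x ∈ X, 0 ≤ inner ℝ (gradX f xs ys z) (x - xs) := by
    filter_upwards [hΦ] with z hz x hx
    rw [← neg_nonpos]
    refine nonpos_of_mul_le_sq_mul (b := β / 2 * ‖x - xs‖ ^ 2) fun s hs hs1 => ?_
    have hmem : xs + s • (x - xs) ∈ X := h.scsc.convex_X.add_smul_sub_mem hX hx ⟨hs.le, hs1⟩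
    have h1 := (h.scsc.isSaddleFunction hβ.le z).smooth_x xs hX _ hmem ys hY
    have h2 := h0 _ hmem ys hY z
    rw [add_sub_cancel_left, inner_smul_right, norm_smul, mul_pow,
      Real.norm_of_nonneg hs.le] at h1
    simp only [Pi.zero_apply] at hz
    rw [hz] at h1
    linarith
  have heach : ∀ x ∈ X, ∀ᵐ z ∂P, inner ℝ (gradX f xs ys z) (x - xs) = 0 := fun x hx => by
    have h1 := h.integral_inner_x (x - xs)
    rw [hG, inner_zero_left] at h1
    exact (integral_eq_zero_iff_of_nonneg_ae (hnn.mono fun z hz => hz x hx)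
      (h.integrable_inner_x _)).1 h1
  -- The null set depends on `x`. A countable dense subset of `X` and continuity in `x` give a
  -- common one.
  obtain ⟨s, hsX, hsc, hsd⟩ :=
    (TopologicalSpace.IsSeparable.of_separableSpace X).exists_countable_dense_subset
  have hall : ∀ᵐ z ∂P, ∀ x ∈ s, inner ℝ (gradX f xs ys z) (x - xs) = 0 :=
    (ae_ball_iff hsc).2 fun x hx => heach x (hsX hx)
  filter_upwards [hall] with z hz x hx
  have hcl : IsClosed {x : Vec d | inner ℝ (gradX f xs ys z) (x - xs) = 0} :=
    isClosed_eq (by fun_prop) continuous_const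
  exact closure_minimal (fun x hx => hz x hx) hcl (hsd hx)

end Setting

end Rates

/-! ### Rates for losses that are non-negative on the domain only. -/

section NonnegRates

variable {d d' : ℕ} {Z : Type*} [MeasurableSpace Z] {P : Measure Z} [IsProbabilityMeasure P]
  {β μx μy Bx By DX DY R₁ : ℝ} {X : Set (Vec d)} {Y : Set (Vec d')}
  {f : Vec d → Vec d' → Z → ℝ} {xs : Vec d} {ys : Vec d'}

/-- The inequality keeps `u` away from zero, so a linear term in `u` is dominated by a quadratic
one. -/
theorem le_sq_of_le_quadratic {D g u : ℝ} (hD : 0 ≤ D) (hg : 0 < g) (hu : 0 ≤ u)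
    (h : g ≤ D * (u ^ 2 + u)) : u ≤ (1 + 2 * D / g) * u ^ 2 := by
  have h2 : 0 ≤ 2 * D / g * u ^ 2 := by positivity
  rcases le_total 1 u with h1 | h1
  · nlinarith
  · have h3 : g ≤ 2 * D * u := by nlinarith [mul_nonneg hD hu]
    have h4 : u ≤ 2 * D / g * u ^ 2 := by
      rw [div_mul_eq_mul_div, le_div_iff₀ hg]
      nlinarith
    nlinarith [sq_nonneg u]

theorem exists_measurable_forall_of_ae {p : Z → Prop} (hp : ∀ᵐ z ∂P, p z) (n : ℕ) :
    ∃ A : Set (Fin n → Z), MeasurableSet A ∧ Measure.pi (fun _ : Fin n => P) A = 1 ∧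
      ∀ S ∈ A, ∀ i, p (S i) := by
  have h : ∀ᵐ S ∂(Measure.pi fun _ : Fin n => P), ∀ i, p (S i) :=
    Filter.eventually_all.2 fun i =>
      (Measure.tendsto_eval_ae_ae (μ := fun _ : Fin n => P) (i := i)).eventually hp
  refine ⟨(toMeasurable (Measure.pi fun _ : Fin n => P) {S | ∀ i, p (S i)}ᶜ)ᶜ,
    (measurableSet_toMeasurable _ _).compl, ?_, fun S hS => ?_⟩
  · rw [prob_compl_eq_one_iff (measurableSet_toMeasurable _ _), measure_toMeasurable]
    exact h
  · exact not_not.1 fun hc => hS (subset_toMeasurable _ _ hc)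

namespace Setting

/-- Either no sample of the event has its iterates in the domain, or the fixed number `‖G‖` is at
most `O(e + 1/T)`, which forces `u = O(u²)` and turns the variance term into one of second order. -/
theorem exists_rate_of_gradX_ne_zero (h : Setting β μx μy Bx By DX DY R₁ P X Y f xs ys)
    (hβ : 0 < β) (hμx : 0 < μx) (hμy : 0 < μy) (hBx : 0 < Bx) (hBy : 0 < By) (hDX : 0 < DX)
    {a : ℝ} (ha : 0 < a) (hG : ∫ z, gradX f xs ys z ∂P ≠ 0) :
    ∃ C : ℝ, 0 < C ∧ ∀ (δ : ℝ) (n T : ℕ), 0 < δ → δ < 1 → 0 < n → a * n ≤ T →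
      ExcessRiskBound β μy P X Y f xs n T δ (C * (Real.log (8 / δ) / n) ^ 2) := by
  have hVx : 0 ≤ ∫ z, ‖gradX f xs ys z‖ ^ 2 ∂P := integral_nonneg fun z => by positivity
  have hVy : 0 ≤ ∫ z, ‖gradY f xs ys z‖ ^ 2 ∂P := integral_nonneg fun z => by positivity
  have hC0 := rateBound_pos (μx := μx) (Bx := Bx) (By := By) (DY := DY) hβ hμy hDX ha
  have hg : 0 < ‖∫ z, gradX f xs ys z ∂P‖ := norm_pos_iff.2 hG
  have hV := add_nonneg hVx hVy
  obtain ⟨V, hVdef⟩ : ∃ V, V = (∫ z, ‖gradX f xs ys z‖ ^ 2 ∂P) +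
    ∫ z, ‖gradY f xs ys z‖ ^ 2 ∂P := ⟨_, rfl⟩
  obtain ⟨C₀, hC₀⟩ : ∃ C₀, C₀ = rateBound β μx μy Bx By DX DY a := ⟨_, rfl⟩
  obtain ⟨Q, hQ⟩ : ∃ Q, Q = iterateBound β μx μy DX DY := ⟨_, rfl⟩
  obtain ⟨D, hD⟩ : ∃ D, D = 2 * Q ^ 2 * (128 * (Bx ^ 2 + By ^ 2) + 32 * V + 1 / a ^ 2) :=
    ⟨_, rfl⟩
  obtain ⟨g, hgdef⟩ : ∃ g, g = ‖∫ z, gradX f xs ys z ∂P‖ ^ 2 := ⟨_, rfl⟩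
  rw [← hVdef] at hV
  rw [← hC₀] at hC0
  have hD0 : 0 ≤ D := by rw [hD]; positivity
  have hg0 : 0 < g := by rw [hgdef]; positivity
  have hpos : 0 < V * (1 + 2 * D / g + 1 / a) + 1 := by positivity
  refine ⟨C₀ * (V * (1 + 2 * D / g + 1 / a) + 1), mul_pos hC0 hpos,
    fun δ n T hδ hδ1 hn hT => ?_⟩
  have hn' : (0 : ℝ) < n := by exact_mod_cast hn
  have hu : 1 / (n : ℝ) ≤ Real.log (8 / δ) / n := by
    gcongr; exact one_le_log_eight_div hδ hδ1
  obtain ⟨A, hA, hP, hS⟩ := h.exists_event hBx hBy hδ hδ1 hn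
  generalize Real.log (8 / δ) / n = u at hu hS ⊢
  have hu0 : 0 < u := lt_of_lt_of_le (by positivity) hu
  refine ⟨A, hA, hP, fun S hSA hdom => ?_⟩
  refine (h.excess_le hβ hμx hμy hDX ha hn hT hu (hS S hSA) hdom).trans ?_
  rw [← hVdef, ← hC₀]
  have hT0 : (0 : ℝ) < T := lt_of_lt_of_le (by positivity) hT
  have hTu : 1 / (T : ℝ) ≤ u / a := by
    rw [div_le_div_iff₀ hT0 ha]
    rw [div_le_iff₀ hn'] at hu
    nlinarith
  have key : u ≤ (1 + 2 * D / g + 1 / a) * u ^ 2 := by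
    obtain rfl | ⟨N, rfl⟩ : T = 1 ∨ ∃ N, T = N + 2 := by
      have : 0 < T := by exact_mod_cast hT0
      rcases T with _ | _ | N
      · omega
      · exact Or.inl rfl
      · exact Or.inr ⟨N, rfl⟩
    · have h1 : 1 ≤ u / a := by simpa using hTu
      have h2 : u ≤ 1 / a * u ^ 2 := by
        have : 1 / a * u ^ 2 = u / a * u := by ring
        rw [this]
        nlinarith
      have : 0 ≤ (1 + 2 * D / g) * u ^ 2 := by positivity
      linarith
    · obtain ⟨e, he, heX, heY, he2⟩ := (hS S hSA).exists_deviation hu0.le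
      have h1 := h.norm_integral_gradX_le hβ hμx hμy hn hdom heX heY
      rw [← hVdef] at he2
      rw [← hQ] at h1
      set w := 1 / ((N + 2 : ℕ) : ℝ)
      have hw : 0 ≤ w := by positivity
      have hgD : g ≤ D * (u ^ 2 + u) := by
        have a1 : g ≤ (Q * (e + w)) ^ 2 := by rw [hgdef]; gcongr
        have a2 : w ^ 2 ≤ (u / a) ^ 2 := by gcongr
        have a3 : (e + w) ^ 2 ≤ 2 * (e ^ 2 + (u / a) ^ 2) := by nlinarith [sq_nonneg (e - w)]
        have a4 : 0 ≤ (128 * (Bx ^ 2 + By ^ 2) + 1 / a ^ 2) * u + 32 * V * u ^ 2 := by positivity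
        have a5 : e ^ 2 + (u / a) ^ 2 ≤
            (128 * (Bx ^ 2 + By ^ 2) + 32 * V + 1 / a ^ 2) * (u ^ 2 + u) := by
          have : (u / a) ^ 2 = 1 / a ^ 2 * u ^ 2 := by ring
          rw [he2, this]
          linarith
        calc g ≤ Q ^ 2 * (e + w) ^ 2 := by rw [← mul_pow]; exact a1
          _ ≤ Q ^ 2 * (2 * ((128 * (Bx ^ 2 + By ^ 2) + 32 * V + 1 / a ^ 2) * (u ^ 2 + u))) :=
            mul_le_mul_of_nonneg_left (by linarith) (sq_nonneg _)
          _ = D * (u ^ 2 + u) := by rw [hD]; ring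
      have h2 := le_sq_of_le_quadratic hD0 hg0 hu0.le hgD
      have : 0 ≤ 1 / a * u ^ 2 := mul_nonneg (one_div_nonneg.2 ha.le) (sq_nonneg u)
      linarith
  have h3 := mul_le_mul_of_nonneg_left key hV
  rw [mul_assoc]
  refine mul_le_mul_of_nonneg_left ?_ hC0.le
  linarith

/-- Almost surely all deviations in directions of the domain are zero: in `x` by orthogonality, in
`y` because `Y` is one point. Only the optimization error `O(1/T)` remains. -/
theorem exists_rate_of_gradX_eq_zero (h : Setting β μx μy Bx By DX DY R₁ P X Y f xs ys)
    (hβ : 0 < β) (hμx : 0 < μx) (hμy : 0 < μy) (hDX : 0 < DX) {a : ℝ} (ha : 0 < a)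
    (h0 : ∀ x ∈ X, ∀ y ∈ Y, ∀ z, 0 ≤ f x y z) (hΦ : primal P Y f xs = 0)
    (hG : ∫ z, gradX f xs ys z ∂P = 0) :
    ∃ C : ℝ, 0 < C ∧ ∀ (δ : ℝ) (n T : ℕ), 0 < δ → δ < 1 → 0 < n → a * n ≤ T →
      ExcessRiskBound β μy P X Y f xs n T δ (C * (Real.log (8 / δ) / n) ^ 2) := by
  have hL : 0 < primalSmoothness β μy := by unfold primalSmoothness; positivity
  set L := primalSmoothness β μy
  set Q := iterateBound β μx μy DX DY with hQ
  refine ⟨L * (4 * DX + Q ^ 2) / a ^ 2, by positivity, fun δ n T hδ hδ1 hn hT => ?_⟩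
  have hn' : (0 : ℝ) < n := by exact_mod_cast hn
  have hu : 1 / (n : ℝ) ≤ Real.log (8 / δ) / n := by
    gcongr; exact one_le_log_eight_div hδ hδ1
  set u := Real.log (8 / δ) / n
  have hu0 : 0 < u := lt_of_lt_of_le (by positivity) hu
  obtain ⟨A, hA, hP, hS⟩ := exists_measurable_forall_of_ae
    (h.ae_inner_gradX_eq_zero hβ h0 hΦ hG) n
  refine ⟨A, hA, ?_, fun S hSA hdom => ?_⟩
  · rw [hP, ← ENNReal.ofReal_one]
    exact ENNReal.ofReal_le_ofReal (by linarith)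
  have hT0 : (0 : ℝ) < T := lt_of_lt_of_le (by positivity) hT
  have hTu : 1 / (T : ℝ) ≤ u / a := by
    rw [div_le_div_iff₀ hT0 ha]
    rw [div_le_iff₀ hn'] at hu
    nlinarith
  have hmem := h.gdaAvg_mem (by exact_mod_cast hT0) hdom
  have h1 := h.excess_le_of_norm_le hβ hμy hmem
  rw [hG, norm_zero, zero_mul, zero_add] at h1
  refine h1.trans ?_
  have e1 : L * (4 * DX + Q ^ 2) / a ^ 2 * u ^ 2 = L * ((4 * DX + Q ^ 2) * (u / a) ^ 2) := by
    ring
  rw [e1]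
  refine mul_le_mul_of_nonneg_left ?_ hL.le
  obtain rfl | ⟨N, rfl⟩ : T = 1 ∨ ∃ N, T = N + 2 := by
    have : 0 < T := by exact_mod_cast hT0
    rcases T with _ | _ | N
    · omega
    · exact Or.inl rfl
    · exact Or.inr ⟨N, rfl⟩
  · have h2 : 1 ≤ u / a := by simpa using hTu
    refine (h.norm_sub_sq_le hmem).trans ?_
    have : 1 ≤ (u / a) ^ 2 := one_le_pow₀ h2
    nlinarith [sq_nonneg Q]
  · have h2 := h.norm_gdaAvg_sub_le hβ hμx hμy hn hdom le_rfl
      (fun x hx => by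
        rw [hG, sub_zero, real_inner_smul_left, sum_inner,
          Finset.sum_eq_zero fun i _ => hS S hSA i x hx]
        simp)
      (fun y hy => by rw [h.eq_of_primal_eq_zero hβ hμy h0 hΦ hy]; simp)
    rw [zero_add] at h2
    calc ‖gdaAvg β μy f S (N + 2) - xs‖ ^ 2 ≤ (Q * (1 / ((N + 2 : ℕ) : ℝ))) ^ 2 := by gcongr
      _ = Q ^ 2 * (1 / ((N + 2 : ℕ) : ℝ)) ^ 2 := by ring
      _ ≤ Q ^ 2 * (u / a) ^ 2 := by gcongr
      _ ≤ (4 * DX + Q ^ 2) * (u / a) ^ 2 := by gcongr; linarith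

theorem exists_rate_of_nonneg (h : Setting β μx μy Bx By DX DY R₁ P X Y f xs ys)
    (hβ : 0 < β) (hμx : 0 < μx) (hμy : 0 < μy) (hBx : 0 < Bx) (hBy : 0 < By) (hDX : 0 < DX)
    {a : ℝ} (ha : 0 < a) (h0 : ∀ x ∈ X, ∀ y ∈ Y, ∀ z, 0 ≤ f x y z) :
    ∃ C : ℝ, 0 < C ∧ ∀ (δ : ℝ) (n T : ℕ), 0 < δ → δ < 1 → 0 < n → a * n ≤ T →
      ExcessRiskBound β μy P X Y f xs n T δ
        (C * (primal P Y f xs * (Real.log (8 / δ) / n) + (Real.log (8 / δ) / n) ^ 2)) := by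
  rcases (h.primal_nonneg h0).eq_or_lt with hΦ | hΦ
  · simp only [← hΦ, zero_mul, zero_add]
    by_cases hG : ∫ z, gradX f xs ys z ∂P = 0
    · exact h.exists_rate_of_gradX_eq_zero hβ hμx hμy hDX ha h0 hΦ.symm hG
    · exact h.exists_rate_of_gradX_ne_zero hβ hμx hμy hBx hBy hDX ha hG
  · have hVx : 0 ≤ ∫ z, ‖gradX f xs ys z‖ ^ 2 ∂P := integral_nonneg fun z => by positivity
    have hVy : 0 ≤ ∫ z, ‖gradY f xs ys z‖ ^ 2 ∂P := integral_nonneg fun z => by positivity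
    have hC0 := rateBound_pos (μx := μx) (Bx := Bx) (By := By) (DY := DY) hβ hμy hDX ha
    set φ := primal P Y f xs
    -- A positive primal value is a fixed number of the problem, so the variance is a constant
    -- multiple of it.
    refine ⟨rateBound β μx μy Bx By DX DY a * (((∫ z, ‖gradX f xs ys z‖ ^ 2 ∂P) +
      ∫ z, ‖gradY f xs ys z‖ ^ 2 ∂P) / φ + 1), by positivity, fun δ n T hδ hδ1 hn hT => ?_⟩
    refine (h.excessRiskBound hβ hμx hμy hBx hBy hDX ha hδ hδ1 hn hT).mono ?_
    have hℓ := one_le_log_eight_div hδ hδ1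
    set V := (∫ z, ‖gradX f xs ys z‖ ^ 2 ∂P) + ∫ z, ‖gradY f xs ys z‖ ^ 2 ∂P
    have hV : 0 ≤ V := add_nonneg hVx hVy
    set u := Real.log (8 / δ) / n
    have hu : 0 ≤ u := by positivity
    rw [mul_assoc]
    refine mul_le_mul_of_nonneg_left ?_ hC0.le
    have e : (V / φ + 1) * (φ * u + u ^ 2) = V * u + u ^ 2 + (V / φ * u ^ 2 + φ * u) := by
      field_simp; ring
    rw [e]
    exact le_add_of_nonneg_right (by positivity)

end Setting

end NonnegRates

theorem small_primal_le {φ K ℓ n C : ℝ} (hC : 0 ≤ C) (hn : 0 < n) (hK : 0 ≤ K) (hℓ : 1 ≤ ℓ)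
    (hφ : φ ≤ K / n) : C * (φ * (ℓ / n) + (ℓ / n) ^ 2) ≤ C * (K + 1) * (ℓ ^ 2 / n ^ 2) := by
  rw [mul_assoc]
  refine mul_le_mul_of_nonneg_left ?_ hC
  have h1 : φ * (ℓ / n) ≤ K / n * (ℓ / n) := by gcongr
  have h2 : K / n * (ℓ / n) ≤ K * (ℓ / n) ^ 2 := by
    have e1 : K / n * (ℓ / n) = K * (ℓ / n ^ 2) := by field_simp
    have e2 : K * (ℓ / n) ^ 2 = K * (ℓ ^ 2 / n ^ 2) := by rw [div_pow]
    rw [e1, e2]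
    gcongr
    nlinarith
  rw [← div_pow]
  linarith

theorem mul_le_of_mul_sq_le {a : ℝ} (ha : 0 < a) {n T : ℕ} (hn : 0 < n)
    (h : a * (n : ℝ) ^ 2 ≤ T) : a * n ≤ T := by
  refine le_trans ?_ h
  have : (1 : ℝ) ≤ n := by exact_mod_cast hn
  gcongr
  nlinarith

end Minimax

end

theorem theorem6 :
    -- `c` is an absolute constant
    ∃ c : ℝ, 0 < c ∧
    ∀ β μx μy Bx By DX DY a b : ℝ, 0 < β → 0 < μx → 0 < μy → 0 < Bx → 0 < By → 0 < DX → 0 < DY →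
      0 < a → 0 < b →
    -- the rates for `T ≍ n` and, for non-negative `f`, for `T ≍ n ^ 2`
    (∃ C : ℝ, 0 < C ∧
      ∀ (d d' : ℕ) (Z : Type u) [MeasurableSpace Z] (P : MeasureTheory.Measure Z)
        [MeasureTheory.IsProbabilityMeasure P] (X : Set (Minimax.Vec d)) (Y : Set (Minimax.Vec d'))
        (f : Minimax.Vec d → Minimax.Vec d' → Z → ℝ) (xs : Minimax.Vec d) (ys : Minimax.Vec d')
        (R₁ : ℝ),
        Minimax.Setting β μx μy Bx By DX DY R₁ P X Y f xs ys →
        ∀ (δ : ℝ) (n T : ℕ), 0 < δ → δ < 1 → 0 < n → Minimax.LargeSample c β μx μy R₁ d n δ →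
          (a * (n : ℝ) ≤ T → (T : ℝ) ≤ b * n →
            Minimax.ExcessRiskBound β μy P X Y f xs n T δ
              (C * ((∫ z, ‖Minimax.gradX f xs ys z‖ ^ 2 ∂P) * Real.log (8 / δ) / n +
                (∫ z, ‖Minimax.gradY f xs ys z‖ ^ 2 ∂P) * Real.log (8 / δ) / n +
                Real.log (8 / δ) ^ 2 / (n : ℝ) ^ 2))) ∧
          (a * (n : ℝ) ^ 2 ≤ T → (T : ℝ) ≤ b * (n : ℝ) ^ 2 →
            Minimax.IsSmoothOn β Set.univ Set.univ f → (∀ x y z, 0 ≤ f x y z) →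
            Minimax.ExcessRiskBound β μy P X Y f xs n T δ
              (C * (Minimax.primal P Y f xs * Real.log (8 / δ) / n +
                Real.log (8 / δ) ^ 2 / (n : ℝ) ^ 2)))) ∧
    -- the rate for `T ≍ n ^ 2`, non-negative `f` and `Φ(x*) ≤ K / n`
    (∀ K : ℝ, 0 < K → ∃ C : ℝ, 0 < C ∧
      ∀ (d d' : ℕ) (Z : Type u) [MeasurableSpace Z] (P : MeasureTheory.Measure Z)
        [MeasureTheory.IsProbabilityMeasure P] (X : Set (Minimax.Vec d)) (Y : Set (Minimax.Vec d'))
        (f : Minimax.Vec d → Minimax.Vec d' → Z → ℝ) (xs : Minimax.Vec d) (ys : Minimax.Vec d')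
        (R₁ : ℝ),
        Minimax.Setting β μx μy Bx By DX DY R₁ P X Y f xs ys →
        Minimax.IsSmoothOn β Set.univ Set.univ f → (∀ x y z, 0 ≤ f x y z) →
        ∀ (δ : ℝ) (n T : ℕ), 0 < δ → δ < 1 → 0 < n → Minimax.LargeSample c β μx μy R₁ d n δ →
          a * (n : ℝ) ^ 2 ≤ T → (T : ℝ) ≤ b * (n : ℝ) ^ 2 → Minimax.primal P Y f xs ≤ K / n →
          Minimax.ExcessRiskBound β μy P X Y f xs n T δ
            (C * (Real.log (8 / δ) ^ 2 / (n : ℝ) ^ 2))) ∧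
    -- `f` non-negative and smooth on `X × Y` only: constants that may depend on the problem
    (∀ (d d' : ℕ) (Z : Type u) [MeasurableSpace Z] (P : MeasureTheory.Measure Z)
        [MeasureTheory.IsProbabilityMeasure P] (X : Set (Minimax.Vec d)) (Y : Set (Minimax.Vec d'))
        (f : Minimax.Vec d → Minimax.Vec d' → Z → ℝ) (xs : Minimax.Vec d) (ys : Minimax.Vec d')
        (R₁ : ℝ),
        Minimax.Setting β μx μy Bx By DX DY R₁ P X Y f xs ys →
        (∀ x ∈ X, ∀ y ∈ Y, ∀ z, 0 ≤ f x y z) →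
        (∃ C : ℝ, 0 < C ∧ ∀ (δ : ℝ) (n T : ℕ), 0 < δ → δ < 1 → 0 < n →
          Minimax.LargeSample c β μx μy R₁ d n δ →
          a * (n : ℝ) ^ 2 ≤ T → (T : ℝ) ≤ b * (n : ℝ) ^ 2 →
          Minimax.ExcessRiskBound β μy P X Y f xs n T δ
            (C * (Minimax.primal P Y f xs * Real.log (8 / δ) / n +
              Real.log (8 / δ) ^ 2 / (n : ℝ) ^ 2))) ∧
        (∀ K : ℝ, 0 < K → ∃ C : ℝ, 0 < C ∧ ∀ (δ : ℝ) (n T : ℕ), 0 < δ → δ < 1 → 0 < n →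
          Minimax.LargeSample c β μx μy R₁ d n δ →
          a * (n : ℝ) ^ 2 ≤ T → (T : ℝ) ≤ b * (n : ℝ) ^ 2 → Minimax.primal P Y f xs ≤ K / n →
          Minimax.ExcessRiskBound β μy P X Y f xs n T δ
            (C * (Real.log (8 / δ) ^ 2 / (n : ℝ) ^ 2)))) := by
  refine ⟨1, one_pos, ?_⟩
  intro β μx μy Bx By DX DY a b hβ hμx hμy hBx hBy hDX _ ha _
  have hC := Minimax.rateBound_pos (μx := μx) (Bx := Bx) (By := By) (DY := DY) hβ hμy hDX ha
  set C := Minimax.rateBound β μx μy Bx By DX DY a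
  -- The factor `4 * β` comes from self-bounding. The `+ 1` keeps the `u²` term and lets the same
  -- constant serve part 1.
  have hselfBound : ∀ {V φ u : ℝ}, V ≤ 4 * β * φ → 0 ≤ φ → 0 ≤ u →
      C * (V * u + u ^ 2) ≤ C * (4 * β + 1) * (φ * u + u ^ 2) := fun {V φ u} hV hφ hu => by
    rw [mul_assoc]
    refine mul_le_mul_of_nonneg_left ?_ hC.le
    have h1 : V * u ≤ 4 * β * φ * u := by gcongr
    have h2 : 0 ≤ φ * u + 4 * β * u ^ 2 := by positivity
    linarith
  refine ⟨⟨C * (4 * β + 1), by positivity, ?_⟩, ?_, ?_⟩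
  · intro d d' Z _ P _ X Y f xs ys R₁ h δ n T hδ hδ1 hn _
    have hℓ := Minimax.one_le_log_eight_div hδ hδ1
    refine ⟨fun hT _ => ?_, fun hT _ hs h0 => ?_⟩
    · refine (h.excessRiskBound hβ hμx hμy hBx hBy hDX ha hδ hδ1 hn hT).mono ?_
      have hVx : 0 ≤ ∫ z, ‖Minimax.gradX f xs ys z‖ ^ 2 ∂P :=
        MeasureTheory.integral_nonneg fun z => by positivity
      have hVy : 0 ≤ ∫ z, ‖Minimax.gradY f xs ys z‖ ^ 2 ∂P :=
        MeasureTheory.integral_nonneg fun z => by positivity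
      rw [mul_div_assoc, mul_div_assoc, ← div_pow, ← add_mul]
      refine mul_le_mul_of_nonneg_right ?_ (by positivity)
      nlinarith [mul_pos hC hβ]
    · refine (h.excessRiskBound hβ hμx hμy hBx hBy hDX ha hδ hδ1 hn
        (Minimax.mul_le_of_mul_sq_le ha hn hT)).mono ?_
      rw [mul_div_assoc, ← div_pow]
      exact hselfBound (h.integral_norm_grad_sq_le hβ hs h0)
        (h.primal_nonneg fun x _ y _ z => h0 x y z) (by positivity)
  · intro K hK
    refine ⟨C * (4 * β + 1) * (K + 1), by positivity, ?_⟩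
    intro d d' Z _ P _ X Y f xs ys R₁ h hs h0 δ n T hδ hδ1 hn _ hT _ hφ
    have hℓ := Minimax.one_le_log_eight_div hδ hδ1
    refine (h.excessRiskBound hβ hμx hμy hBx hBy hDX ha hδ hδ1 hn
      (Minimax.mul_le_of_mul_sq_le ha hn hT)).mono ?_
    exact (hselfBound (h.integral_norm_grad_sq_le hβ hs h0)
      (h.primal_nonneg fun x _ y _ z => h0 x y z) (by positivity)).trans
      (Minimax.small_primal_le (by positivity) (by exact_mod_cast hn) hK.le hℓ hφ)
  · intro d d' Z _ P _ X Y f xs ys R₁ h h0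
    obtain ⟨C', hC', hrate⟩ := h.exists_rate_of_nonneg hβ hμx hμy hBx hBy hDX ha h0
    refine ⟨⟨C', hC', ?_⟩, fun K hK => ⟨C' * (K + 1), by positivity, ?_⟩⟩
    · intro δ n T hδ hδ1 hn _ hT _
      rw [mul_div_assoc, ← div_pow]
      exact hrate δ n T hδ hδ1 hn (Minimax.mul_le_of_mul_sq_le ha hn hT)
    · intro δ n T hδ hδ1 hn _ hT _ hφ
      exact (hrate δ n T hδ hδ1 hn (Minimax.mul_le_of_mul_sq_le ha hn hT)).mono
        (Minimax.small_primal_le hC'.le (by exact_mod_cast hn) hK.le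
          (Minimax.one_le_log_eight_div hδ hδ1) hφ)
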